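/- **Setting.** $M$ (memory) and $S$ (system) are two fermionic modes with annihilation operators $c_M,c_S$ on the Fock space $\mathbb C^2\otimes\mathbb C^2$ with occupation basis $|m_M\rangle|s_S\rangle=(c_M^\dagger)^m(c_S^\dagger)^s|\mathrm{vac}\rangle$. A two-mode fermionic state is a density matrix $\rho_{MS}$ that obeys the parity superselection rule, i.e. commutes with the parity $(1-2c_M^\dagger c_M)(1-2c_S^\dagger c_S)$. It is separable if $\rho_{MS}=\sum_k\lambda_k\,\rho_M^k\otimes\rho_S^k$ (a finite sum) with $\lambda_k>0$, $\sum_k\lambda_k=1$ and $\rho_M^k,\rho_S^k$ positive semidefinite with trace $1$; otherwise it is entangled. The reservoir $R$ has a nonzero Hilbert space, of finite or infinite dimension, and a Hamiltonian $H_R$ such that, for the inverse temperature $\beta>0$, $\operatorname{Tr}e^{-\beta H_R}<\infty$ and the Gibbs state $\rho_R^{\mathrm{eq}}=e^{-\beta H_R}/\operatorname{Tr}e^{-\beta H_R}$ has finite mean energy. A process is an arbitrary unitary $U$ on $\mathbb C^2\otimes\mathbb C^2\otimes\mathcal H_R$, acting as $\rho_{MS}\otimes\rho_R^{\mathrm{eq}}\mapsto\rho_{MSR}(t)=U(\rho_{MS}\otimes\rho_R^{\mathrm{eq}})U^\dagger$,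 such that the final reservoir state $\rho_R(t)$ has finite mean energy. The heat $Q$ is defined by $-Q=\operatorname{Tr}\{H_R[\rho_R(t)-\rho_R^{\mathrm{eq}}]\}$. For $X\in\{M,S\}$, $n_X^0$ and $n_X^1$ are the expectation values of $c_X^\dagger c_X$ in the initial state $\rho_{MS}$ and in the final state $\operatorname{Tr}_R\rho_{MSR}(t)$, and $h(x)=-x\ln x-(1-x)\ln(1-x)$. **Statement.** 1. For every separable two-mode fermionic state $\rho_{MS}$ and every process, $$h(n_S^1)+h(n_M^1)-\max\left[h(n_S^0),h(n_M^0)\right]-\beta Q\ \ge\ 0 .$$ 2. Consequently, if for some two-mode fermionic state $\rho_{MS}$ and some process the left-hand side is negative, then $\rho_{MS}$ is entangled. 3. The pure state $|\Psi\rangle=\frac1{\sqrt2}\left(|1_M\rangle|0_S\rangle+i|0_M\rangle|1_S\rangle\right)$ is a two-mode fermionic state. Let $V$ be any unitary on $\mathbb C^2\otimes\mathbb C^2$ that takes $|\Psi\rangle\langle\Psi|$ to the projector on $|0_M\rangle|1_S\rangle$. Then for every $\tau\in\mathbb R$ the process $U=V\otimes e^{-iH_R\tau}$ (reservoir isolated)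 has final two-mode state $|0_M\rangle|1_S\rangle$ and final reservoir state of finite mean energy, $Q=0$, and the left-hand side of the inequality equals $-\ln 2<0$. Such a $V$ is realized by the tunnel coupling $H=\hbar\Omega(c_M^\dagger c_S+c_S^\dagger c_M)$, $\hbar>0$, at zero mode energies: $V=e^{-iHt/\hbar}$ with $t=\pi/(4|\Omega|)$ if $\Omega<0$, and with $t=3\pi/(4\Omega)$ if $\Omega>0$. -/

import Mathlib

open scoped Kronecker InnerProductSpace ComplexOrder

noncomputable section

namespace FermionThermo

/-! ### Two fermionic modes: the memory `M` and the system `S`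

Operators on the two-mode Fock space `ℂ² ⊗ ℂ²` are matrices in the occupation basis
`|m⟩_M |s⟩_S = (c_M†)^m (c_S†)^s |vac⟩`, indexed by the pair `(m, s)`. -/

/-- Occupation numbers of one mode: `0` is empty, `1` is occupied. -/
abbrev Occ := Fin 2

abbrev OneModeOp := Matrix Occ Occ ℂ

abbrev TwoModeOp := Matrix (Occ × Occ) (Occ × Occ) ℂ

/-- The annihilation operator `c_M`: `|1, s⟩ ↦ |0, s⟩`, `|0, s⟩ ↦ 0`. -/
def annM : TwoModeOp := fun j k => if k.1 = 1 ∧ j = (0, k.2) then 1 else 0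

/-- The annihilation operator `c_S`: `|m, 1⟩ ↦ (-1)^m |m, 0⟩`, `|m, 0⟩ ↦ 0`
(the sign makes `c_S` anticommute with `c_M` and `c_M†`). -/
def annS : TwoModeOp := fun j k => if k.2 = 1 ∧ j = (k.1, 0) then (-1) ^ (k.1 : ℕ) else 0

/-- The number operator `c† c`. -/
def numOp (c : TwoModeOp) : TwoModeOp := c.conjTranspose * c

/-- The particle-number parity `(1 - 2 c_M† c_M) (1 - 2 c_S† c_S)`. -/
def parity : TwoModeOp := (1 - (2 : ℂ) • numOp annM) * (1 - (2 : ℂ) • numOp annS)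

/-- The canonical anticommutation relations. -/
theorem car :
    annM * annM.conjTranspose + annM.conjTranspose * annM = 1 ∧
    annS * annS.conjTranspose + annS.conjTranspose * annS = 1 ∧
    annM * annM = 0 ∧ annS * annS = 0 ∧
    annM * annS + annS * annM = 0 ∧
    annM * annS.conjTranspose + annS.conjTranspose * annM = 0 := by
  refine ⟨?_, ?_, ?_, ?_, ?_, ?_⟩ <;> ext ⟨a, b⟩ ⟨c, d⟩ <;>
    fin_cases a <;> fin_cases b <;> fin_cases c <;> fin_cases d <;>
    simp [annM, annS, Matrix.mul_apply, Fintype.sum_prod_type, Fin.sum_univ_two]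

/-- Density matrices: positive semidefinite with trace one. -/
structure IsDensity {n : Type*} [Fintype n] (ρ : Matrix n n ℂ) : Prop where
  posSemidef : ρ.PosSemidef
  trace_eq_one : ρ.trace = 1

/-- A state of two fermionic modes: a density matrix that obeys the parity superselection rule,
i.e. without coherence between even and odd particle number. -/
structure IsFermionicState (ρ : TwoModeOp) : Prop extends IsDensity ρ where
  superselection : Commute parity ρ

/-- Separability: `ρ = ∑ₖ λₖ ρ_M^k ⊗ ρ_S^k` with positive probabilities `λₖ` and one-mode
density matrices `ρ_M^k`, `ρ_S^k`. -/
def IsSeparable (ρ : TwoModeOp) : Prop :=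
  ∃ (N : ℕ) (w : Fin N → ℝ) (ρM ρS : Fin N → OneModeOp),
    (∀ k, 0 < w k) ∧ ∑ k, w k = 1 ∧
    (∀ k, IsDensity (ρM k)) ∧ (∀ k, IsDensity (ρS k)) ∧
    ρ = ∑ k, (w k : ℂ) • (ρM k ⊗ₖ ρS k)

/-- The occupancy `Tr (c† c ρ)` of the mode with annihilation operator `c`. -/
def occupancy (c : TwoModeOp) (ρ : TwoModeOp) : ℝ := (numOp c * ρ).trace.re

/-- The Hamiltonian `ε_M c_M† c_M + ε_S c_S† c_S + ħ Ω (c_M† c_S + c_S† c_M)`. -/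
def hamMS (hbar εM εS Ω : ℝ) : TwoModeOp :=
  (εM : ℂ) • numOp annM + (εS : ℂ) • numOp annS
    + ((hbar * Ω : ℝ) : ℂ) • (annM.conjTranspose * annS + annS.conjTranspose * annM)

/-- The evolution operator `exp (-i H t / ħ)` of a constant two-mode Hamiltonian. -/
def propagator (hbar : ℝ) (H : TwoModeOp) (t : ℝ) : TwoModeOp :=
  NormedSpace.exp ((-Complex.I * ((t / hbar : ℝ) : ℂ)) • H)

/-- The projector `|ψ⟩⟨ψ|`. -/
def pureState (ψ : Occ × Occ → ℂ) : TwoModeOp := Matrix.vecMulVec ψ (star ψ)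

/-- The one-body state `(|1_M⟩|0_S⟩ + i |0_M⟩|1_S⟩) / √2`. -/
def oneBody : Occ × Occ → ℂ :=
  ((Real.sqrt 2)⁻¹ : ℂ) • (Pi.single (1, 0) 1 + Complex.I • Pi.single (0, 1) 1)

/-- The occupation state `|0_M⟩|1_S⟩`. -/
def zeroOne : Occ × Occ → ℂ := Pi.single (0, 1) 1

/-! ### The reservoir -/

variable {ι K : Type*} [NormedAddCommGroup K] [InnerProductSpace ℂ K]

/-- A reservoir with Hilbert space `K`, of finite or infinite dimension, and Hamiltonian
`H_R = ∑ᵢ Eᵢ |bᵢ⟩⟨bᵢ|`, possibly unbounded, given by an orthonormal eigenbasis `b` and real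
eigenvalues `E`. Every self-adjoint `H_R` for which `exp (-β H_R)` has a finite trace is of
this form. -/
structure Reservoir (ι K : Type*) [NormedAddCommGroup K] [InnerProductSpace ℂ K] where
  basis : HilbertBasis ι ℂ K
  energy : ι → ℝ

namespace Reservoir

/-- `Tr exp (-β H_R)` is finite. -/
def HasPartitionFunction (R : Reservoir ι K) (β : ℝ) : Prop :=
  Summable fun i => Real.exp (-β * R.energy i)

/-- `Tr exp (-β H_R)`. -/
def partitionFunction (R : Reservoir ι K) (β : ℝ) : ℝ :=
  ∑' i, Real.exp (-β * R.energy i)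

/-- The Gibbs state `exp (-β H_R) / Tr exp (-β H_R)`; the series converges in operator norm when
the partition function is finite. -/
def gibbs (R : Reservoir ι K) (β : ℝ) : K →L[ℂ] K :=
  ∑' i, ((Real.exp (-β * R.energy i) / R.partitionFunction β : ℝ) : ℂ) •
    InnerProductSpace.rankOne ℂ (R.basis i) (R.basis i)

/-- The series for `Tr (H_R ρ_R)` converges absolutely. -/
def HasFiniteEnergy (R : Reservoir ι K) (ρR : K →L[ℂ] K) : Prop :=
  Summable fun i => R.energy i * (⟪R.basis i, ρR (R.basis i)⟫_ℂ).re

/-- The reservoir energy `Tr (H_R ρ_R)`, the trace being taken in the eigenbasis of `H_R`. -/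
def meanEnergy (R : Reservoir ι K) (ρR : K →L[ℂ] K) : ℝ :=
  ∑' i, R.energy i * (⟪R.basis i, ρR (R.basis i)⟫_ℂ).re

/-- The orthonormal basis of the vectors `exp (-i Eⱼ τ) bⱼ`. -/
def phaseBasis [CompleteSpace K] (R : Reservoir ι K) (τ : ℝ) : HilbertBasis ι ℂ K :=
  HilbertBasis.mkOfOrthogonalEqBot
    (v := fun j => Complex.exp (((-(R.energy j * τ) : ℝ) : ℂ) * Complex.I) • R.basis j)
    (by
      classical
      have h := R.basis.orthonormal
      rw [orthonormal_iff_ite] at h ⊢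
      intro i j
      rw [inner_smul_left, inner_smul_right, h i j]
      split_ifs with hij
      · subst hij
        rw [mul_one, ← Complex.normSq_eq_conj_mul_self, Complex.normSq_eq_norm_sq,
          Complex.norm_exp_ofReal_mul_I]
        simp
      · simp)
    (by
      rw [Submodule.eq_bot_iff]
      intro x hx
      have h0 : ∀ i, ⟪R.basis i, x⟫_ℂ = 0 := by
        intro i
        have h1 := (Submodule.mem_orthogonal _ x).1 hx _ (Submodule.subset_span ⟨i, rfl⟩)
        rw [inner_smul_left] at h1
        rcases mul_eq_zero.1 h1 with h2 | h2
        · simp [Complex.exp_ne_zero] at h2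
        · exact h2
      apply R.basis.repr.injective
      ext i
      simp [R.basis.repr_apply_apply, h0 i])

/-- The evolution operator `exp (-i H_R τ)` of the isolated reservoir, i.e. the unitary map with
`bⱼ ↦ exp (-i Eⱼ τ) bⱼ` for all `j`. -/
def evolution [CompleteSpace K] (R : Reservoir ι K) (τ : ℝ) : K →L[ℂ] K :=
  ((R.basis.repr.trans (R.phaseBasis τ).repr.symm).toContinuousLinearEquiv : K →L[ℂ] K)

theorem evolution_basis [CompleteSpace K] (R : Reservoir ι K) (τ : ℝ) (j : ι) :
    R.evolution τ (R.basis j)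
      = Complex.exp (((-(R.energy j * τ) : ℝ) : ℂ) * Complex.I) • R.basis j := by
  classical
  have h : (R.phaseBasis τ) j
      = Complex.exp (((-(R.energy j * τ) : ℝ) : ℂ) * Complex.I) • R.basis j := by
    rw [phaseBasis, HilbertBasis.coe_mkOfOrthogonalEqBot]
  rw [← h]
  simp [evolution, HilbertBasis.repr_self, HilbertBasis.repr_symm_single]

end Reservoir

/-! ### The global system `MSR` -/

/-- The Hilbert space `ℂ² ⊗ ℂ² ⊗ K` of memory, system and reservoir: the vector with components
`(x_{ms})` is `∑_{m,s} |m⟩_M |s⟩_S ⊗ x_{ms}`. -/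
abbrev Global (K : Type*) := PiLp 2 (fun _ : Occ × Occ => K)

/-- The map `⟨j| ⊗ 1 : ℂ² ⊗ ℂ² ⊗ K → K`. -/
def component (K : Type*) [NormedAddCommGroup K] [InnerProductSpace ℂ K] (j : Occ × Occ) :
    Global K →L[ℂ] K :=
  PiLp.proj 2 (fun _ : Occ × Occ => K) j

variable [CompleteSpace K]

/-- `A ⊗ T` for a two-mode operator `A` and a reservoir operator `T`, that is
`∑_{j,k} A_{jk} |j⟩⟨k| ⊗ T`. -/
def tensorOp (A : TwoModeOp) (T : K →L[ℂ] K) : Global K →L[ℂ] Global K :=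
  ∑ j, ∑ k, A j k •
    ((component K j).adjoint.comp (T.comp (component K k)))

/-- The block `(⟨j| ⊗ 1) ρ (|k⟩ ⊗ 1)` of a global operator. -/
def block (ρ : Global K →L[ℂ] Global K) (j k : Occ × Occ) : K →L[ℂ] K :=
  (component K j).comp (ρ.comp (component K k).adjoint)

/-- The reduced state `Tr_{MS} ρ` of the reservoir. -/
def reducedR (ρ : Global K →L[ℂ] Global K) : K →L[ℂ] K := ∑ j, block ρ j j

/-- The reduced state `Tr_R ρ` of the two modes. -/
def reducedMS (b : HilbertBasis ι ℂ K) (ρ : Global K →L[ℂ] Global K) : TwoModeOp :=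
  fun j k => ∑' i, ⟪b i, block ρ j k (b i)⟫_ℂ

namespace Reservoir

/-- The final global state `U (ρ_MS ⊗ ρ_R^eq) U†`. -/
def finalState (R : Reservoir ι K) (β : ℝ) (ρ : TwoModeOp) (U : Global K →L[ℂ] Global K) :
    Global K →L[ℂ] Global K :=
  U * tensorOp ρ (R.gibbs β) * star U

/-- The heat `Q`, given by `-Q = Tr (H_R (ρ_R(t) - ρ_R^eq))`. -/
def heat (R : Reservoir ι K) (β : ℝ) (ρ : TwoModeOp) (U : Global K →L[ℂ] Global K) : ℝ :=
  -(R.meanEnergy (reducedR (R.finalState β ρ U)) - R.meanEnergy (R.gibbs β))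

/-- The quantity `h(n_S¹) + h(n_M¹) - max [h(n_S⁰), h(n_M⁰)] - β Q`, with `n⁰` the initial and
`n¹` the final occupancies and `h` the binary entropy (natural logarithm). -/
def witness (R : Reservoir ι K) (β : ℝ) (ρ : TwoModeOp) (U : Global K →L[ℂ] Global K) : ℝ :=
  Real.binEntropy (occupancy annS (reducedMS R.basis (R.finalState β ρ U)))
    + Real.binEntropy (occupancy annM (reducedMS R.basis (R.finalState β ρ U)))
    - max (Real.binEntropy (occupancy annS ρ)) (Real.binEntropy (occupancy annM ρ))
    - β * R.heat β ρ U

end Reservoir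

end FermionThermo

end

/-!
Let `p` be the eigenvalues of the initial two-mode state `ρ`. The inequality for separable states is
the combination of two bounds on the von Neumann entropy `-∑ p log p`.

* For every process, `-∑ p log p ≤ h(n_S¹) + h(n_M¹) - β Q` (`Reservoir.entropy_le`). This is Klein's
  inequality for the final global state relative to `τ_M ⊗ τ_S ⊗ ρ_R^eq`, where `τ_M` and `τ_S` are
  the diagonal one-mode states with the final occupancies. The reference state is diagonal in the
  product of the occupation basis and the eigenbasis of `H_R`, and the initial global state is
  diagonal in the product of an eigenbasis of `ρ` and that of `H_R`. The unitary therefore enters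
  only through the transition probabilities between two orthonormal bases, which form a doubly
  stochastic kernel by Parseval's identity (`hasSum_norm_sq_inner_productVector`), and no operator
  logarithm is needed: everything follows from the classical inequality
  `tsum_mul_log_le_of_doublyStochastic`, which is a sum of instances of `log x ≤ x - 1`. The finite
  mean energies make the series converge, and the partition function cancels.

* If `ρ` is separable and fermionic, then `h(n_M⁰)` and `h(n_S⁰)` are at most `-∑ p log p`
  (`IsSeparable.max_binEntropy_le`). A one-mode density matrix is at most `1`, so `ρ ≤ ρ_M ⊗ 1`, and
  superselection makes `ρ_M` diagonal in the occupation basis, with entropy `h(n_M⁰)`. For a diagonal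
  upper bound, the required consequence of operator monotonicity of the logarithm has an elementary
  proof (`sum_mul_log_le_of_le_diagonal`).

The explicit violation comes from computing with `tensorOp`: an isolated reservoir stays in the Gibbs
state, since the free evolution commutes with it (`Reservoir.finalState_isolated`). The tunnel
coupling is exponentiated by diagonalizing the hopping operator; at both stated times the phase
`u = exp (-i Ω t)` satisfies `u² = i`, which is all that
`exp_smul_hopping_mulVec_oneBody` uses.
-/

open scoped Kronecker InnerProductSpace ComplexOrder

noncomputable section

namespace FermionThermo

/-! ### Klein's inequality for a doubly stochastic kernel -/

/-- Tonelli for a nonnegative kernel `F` with column sums `q`, tested against `l`. -/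
theorem hasSum_kernel_mul {X Y : Type*} {F : X → Y → ℝ} {q l : Y → ℝ}
    (hF : ∀ x y, 0 ≤ F x y) (hq : ∀ y, HasSum (fun x => F x y) (q y))
    (hl : Summable fun y => q y * l y) :
    HasSum (fun z : X × Y => F z.1 z.2 * l z.2) (∑' y, q y * l y) := by
  have hs : Summable (fun z : Y × X => F z.2 z.1 * l z.1) := by
    rw [← summable_norm_iff, summable_prod_of_nonneg (fun _ => norm_nonneg _)]
    have h1 : ∀ y, HasSum (fun x => ‖F x y * l y‖) (q y * |l y|) := by
      intro y
      simpa [abs_mul, abs_of_nonneg (hF _ _)] using (hq y).mul_right |l y|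
    refine ⟨fun y => (h1 y).summable, ?_⟩
    simp only [(h1 _).tsum_eq]
    refine hl.abs.congr fun y => ?_
    rw [abs_mul, abs_of_nonneg ((hq y).nonneg fun x => hF x y)]
  have h2 := hs.hasSum.prod_fiberwise (fun y => (hq y).mul_right (l y))
  have h3 := hs.hasSum
  rw [← h2.tsum_eq] at h3
  exact (Equiv.prodComm Y X).hasSum_iff.1 (by simpa [Function.comp_def] using h3)

/-- A kernel with row sums `1` preserves total mass. -/
theorem hasSum_of_rowSum_eq_one {X Y : Type*} {D : X → Y → ℝ} {p : X → ℝ} {q : Y → ℝ} {s : ℝ}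
    (hD : ∀ x y, 0 ≤ D x y) (hrow : ∀ x, HasSum (fun y => D x y) 1) (hp : HasSum p s)
    (hq : ∀ y, HasSum (fun x => p x * D x y) (q y)) : HasSum q s := by
  have h := hasSum_kernel_mul (F := fun y x => D x y) (q := fun _ => 1)
    (l := p) (fun y x => hD x y) hrow (by simpa using hp.summable)
  simp only [one_mul, hp.tsum_eq] at h
  exact h.prod_fiberwise fun y => by simpa only [mul_comm] using hq y

/-- If a doubly stochastic kernel `D` carries the distribution `p` to `q`, then the cross entropy of
`q` relative to any distribution `r` is at least the entropy of `p`. -/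
theorem tsum_mul_log_le_of_doublyStochastic {X Y : Type*} {D : X → Y → ℝ}
    {p : X → ℝ} {q r : Y → ℝ}
    (hD : ∀ x y, 0 ≤ D x y) (hrow : ∀ x, HasSum (fun y => D x y) 1)
    (hcol : ∀ y, HasSum (fun x => D x y) 1)
    (hp : ∀ x, 0 ≤ p x) (hr : ∀ y, 0 ≤ r y) (hp1 : HasSum p 1) (hr1 : HasSum r 1)
    (hq : ∀ y, HasSum (fun x => p x * D x y) (q y)) (hrq : ∀ y, r y = 0 → q y = 0)
    (hpl : Summable fun x => p x * Real.log (p x))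
    (hql : Summable fun y => q y * Real.log (r y)) :
    ∑' y, q y * Real.log (r y) ≤ ∑' x, p x * Real.log (p x) := by
  have a1 : HasSum (fun z : X × Y => D z.1 z.2 * (p z.1 * Real.log (p z.1)))
      (∑' x, p x * Real.log (p x)) := by
    have := hasSum_kernel_mul (F := fun y x => D x y) (q := fun _ => 1)
      (l := fun x => p x * Real.log (p x)) (fun y x => hD x y) hrow (by simpa using hpl)
    simpa [Function.comp_def] using (Equiv.prodComm X Y).hasSum_iff.2 this
  have a2 : HasSum (fun z : X × Y => D z.1 z.2 * p z.1) 1 := by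
    have := hasSum_kernel_mul (F := fun y x => D x y) (q := fun _ => 1)
      (l := p) (fun y x => hD x y) hrow (by simpa using hp1.summable)
    simpa [Function.comp_def, hp1.tsum_eq] using (Equiv.prodComm X Y).hasSum_iff.2 this
  have a3 : HasSum (fun z : X × Y => D z.1 z.2 * r z.2) 1 := by
    simpa [hr1.tsum_eq] using hasSum_kernel_mul (q := fun _ => 1)
      (l := r) hD hcol (by simpa using hr1.summable)
  have a4 : HasSum (fun z : X × Y => p z.1 * D z.1 z.2 * Real.log (r z.2))
      (∑' y, q y * Real.log (r y)) :=
    hasSum_kernel_mul (F := fun x y => p x * D x y) (fun x y => mul_nonneg (hp x) (hD x y)) hq hql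
  have h := ((a1.sub a4).sub a2).add a3
  have h0 := h.nonneg (fun z => by
    obtain ⟨x, y⟩ := z
    dsimp only
    rcases (hp x).eq_or_lt with hx | hx
    · simpa [← hx] using mul_nonneg (hD x y) (hr y)
    rcases (hr y).eq_or_lt with hy | hy
    · -- the column of `y` vanishes on the support of `p`
      have h1 := (hasSum_zero_iff_of_nonneg (fun x => mul_nonneg (hp x) (hD x y))).1
        (hrq y hy.symm ▸ hq y)
      have h2 : D x y = 0 := by
        have := congrFun h1 x
        simpa [hx.ne'] using this
      simp [h2]
    · have h1 := Real.log_le_sub_one_of_pos (div_pos hy hx)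
      rw [Real.log_div hy.ne' hx.ne'] at h1
      have h2 : p x * (Real.log (r y) - Real.log (p x)) ≤ r y - p x := by
        calc _ ≤ p x * (r y / p x - 1) := by gcongr
          _ = _ := by field_simp
      have h3 := mul_nonneg (hD x y) (sub_nonneg.2 h2)
      linarith)
  linarith

/-! ### Entropy of a separable two-mode state -/

/-- Spectral decomposition of a density matrix. -/
theorem IsDensity.exists_spectral {n : Type*} [Fintype n] [DecidableEq n] {ρ : Matrix n n ℂ}
    (hρ : IsDensity ρ) :
    ∃ (p : n → ℝ) (W : Matrix n n ℂ), W ∈ unitary (Matrix n n ℂ) ∧ (∀ a, 0 ≤ p a) ∧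
      ∑ a, p a = 1 ∧ ρ = W * Matrix.diagonal (fun a => (p a : ℂ)) * star W := by
  have hH := hρ.posSemidef.isHermitian
  have h := hH.spectral_theorem
  rw [Unitary.conjStarAlgAut_apply] at h
  refine ⟨hH.eigenvalues, hH.eigenvectorUnitary, hH.eigenvectorUnitary.2,
    hρ.posSemidef.eigenvalues_nonneg, ?_, h⟩
  have h1 := hH.trace_eq_sum_eigenvalues
  rw [hρ.trace_eq_one] at h1
  exact Complex.ofReal_injective (by simpa using h1.symm)

theorem mul_diagonal_mul_star_apply {n : Type*} [Fintype n] [DecidableEq n] (W : Matrix n n ℂ)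
    (p : n → ℝ) (j k : n) :
    (W * Matrix.diagonal (fun a => (p a : ℂ)) * star W) j k
      = ∑ a, (p a : ℂ) * (W j a * star (W k a)) := by
  rw [Matrix.mul_apply]
  refine Finset.sum_congr rfl fun a _ => ?_
  rw [Matrix.mul_diagonal, Matrix.star_apply]
  ring

theorem mul_star_self_eq_norm_sq (z : ℂ) : z * star z = ((‖z‖ ^ 2 : ℝ) : ℂ) := by
  have := Complex.mul_conj' z
  exact_mod_cast this

theorem sum_norm_sq_col_of_mem_unitary {n : Type*} [Fintype n] [DecidableEq n] {W : Matrix n n ℂ}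
    (hW : W ∈ unitary (Matrix n n ℂ)) (a : n) : ∑ j, ‖W j a‖ ^ 2 = 1 := by
  have h := Matrix.ext_iff.2 (Unitary.star_mul_self_of_mem hW) a a
  simp only [Matrix.mul_apply, Matrix.star_apply, Matrix.one_apply_eq] at h
  simp only [mul_comm (star _), mul_star_self_eq_norm_sq] at h
  exact_mod_cast h

/-- If `ρ ≤ diag d`, then the entropy of `ρ` is at least its cross entropy relative to `diag d`.
For a unit eigenvector `v` of `ρ` with eigenvalue `p`, testing the operator inequality on
`(diag d)⁻¹ v` gives `p ⟨v, (diag d)⁻¹ v⟩ ≤ 1`, and then `log x ≤ x - 1` gives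
`log p ≤ ⟨v, log (diag d) v⟩`. -/
theorem sum_mul_log_le_of_le_diagonal {n : Type*} [Fintype n] [DecidableEq n] {ρ W : Matrix n n ℂ}
    {p d : n → ℝ} (hW : W ∈ unitary (Matrix n n ℂ)) (hp : ∀ a, 0 ≤ p a)
    (hρ : ρ = W * Matrix.diagonal (fun a => (p a : ℂ)) * star W) (hd : ∀ j, 0 < d j)
    (hle : (Matrix.diagonal (fun j => (d j : ℂ)) - ρ).PosSemidef) :
    ∑ a, p a * Real.log (p a) ≤ ∑ j, (ρ j j).re * Real.log (d j) := by
  set D : Matrix n n ℂ := Matrix.diagonal fun j => (d j : ℂ)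
  set D' : Matrix n n ℂ := Matrix.diagonal fun j => ((d j)⁻¹ : ℂ)
  set P : Matrix n n ℂ := Matrix.diagonal fun j => (p j : ℂ)
  have hDD : D * D' = 1 := by
    simp only [D, D', Matrix.diagonal_mul_diagonal]
    rw [← Matrix.diagonal_one]
    congr 1
    ext j
    exact mul_inv_cancel₀ (by exact_mod_cast (hd j).ne')
  have hD' : star D' = D' := by
    simp [D', Matrix.star_eq_conjTranspose, Matrix.diagonal_conjTranspose, Pi.star_def]
  set G : Matrix n n ℂ := star W * D' * W with hG
  have hGs : star G = G := by simp [hG, hD', mul_assoc]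
  have hps : (G - G * P * G).PosSemidef := by
    have h := hle.conjTranspose_mul_mul_same (D' * W)
    have e : (D' * W).conjTranspose * (D - ρ) * (D' * W) = G - G * P * G := by
      rw [← Matrix.star_eq_conjTranspose, star_mul, hD', hρ, mul_sub, sub_mul]
      congr 1
      · calc star W * D' * D * (D' * W) = star W * D' * (D * D') * W := by noncomm_ring
          _ = G := by rw [hDD, mul_one]
      · rw [hG]; noncomm_ring
    rwa [e] at h
  have hGaa : ∀ a, G a a = ((∑ j, ‖W j a‖ ^ 2 * (d j)⁻¹ : ℝ) : ℂ) := by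
    intro a
    rw [hG, Matrix.mul_apply]
    push_cast
    refine Finset.sum_congr rfl fun j _ => ?_
    have := mul_star_self_eq_norm_sq (W j a)
    push_cast at this
    rw [Matrix.mul_diagonal, Matrix.star_apply, ← this]
    ring
  have key : ∀ a, p a * ∑ j, ‖W j a‖ ^ 2 * (d j)⁻¹ ≤ 1 := by
    intro a
    set t := ∑ j, ‖W j a‖ ^ 2 * (d j)⁻¹
    have ht : 0 ≤ t :=
      Finset.sum_nonneg fun j _ => mul_nonneg (sq_nonneg _) (inv_nonneg.2 (hd j).le)
    have h1 : 0 ≤ (G - G * P * G) a a := hps.diag_nonneg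
    have h2 : (G * P * G) a a = ((∑ b, p b * ‖G a b‖ ^ 2 : ℝ) : ℂ) := by
      conv_lhs => rw [show G * P * G = G * P * star G by rw [hGs]]
      rw [mul_diagonal_mul_star_apply]
      simp only [mul_star_self_eq_norm_sq]
      push_cast
      rfl
    rw [Matrix.sub_apply, h2, hGaa, ← Complex.ofReal_sub] at h1
    have h3 : ∑ b, p b * ‖G a b‖ ^ 2 ≤ t := by
      have : (0 : ℝ) ≤ t - ∑ b, p b * ‖G a b‖ ^ 2 := by exact_mod_cast h1
      linarith
    have h4 : p a * ‖G a a‖ ^ 2 ≤ t :=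
      (Finset.single_le_sum (f := fun b => p b * ‖G a b‖ ^ 2)
        (fun b _ => mul_nonneg (hp b) (sq_nonneg _)) (Finset.mem_univ a)).trans h3
    rw [hGaa, Complex.norm_real, Real.norm_eq_abs, sq_abs] at h4
    rcases ht.eq_or_lt with h0 | h0
    · rw [← h0]; simp
    · nlinarith
  have hlog : ∀ a, p a * Real.log (p a) ≤ p a * ∑ j, ‖W j a‖ ^ 2 * Real.log (d j) := by
    intro a
    rcases (hp a).eq_or_lt with h0 | h0
    · simp [← h0]
    refine mul_le_mul_of_nonneg_left ?_ h0.le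
    have h1 : ∑ j, ‖W j a‖ ^ 2 * (Real.log (p a) - Real.log (d j))
        ≤ ∑ j, ‖W j a‖ ^ 2 * (p a / d j - 1) := by
      refine Finset.sum_le_sum fun j _ => mul_le_mul_of_nonneg_left ?_ (sq_nonneg _)
      rw [← Real.log_div h0.ne' (hd j).ne']
      exact Real.log_le_sub_one_of_pos (div_pos h0 (hd j))
    have h2 : ∑ j, ‖W j a‖ ^ 2 * (p a / d j - 1)
        = p a * ∑ j, ‖W j a‖ ^ 2 * (d j)⁻¹ - ∑ j, ‖W j a‖ ^ 2 := by
      rw [Finset.mul_sum, ← Finset.sum_sub_distrib]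
      exact Finset.sum_congr rfl fun j _ => by ring
    simp only [mul_sub, Finset.sum_sub_distrib, ← Finset.sum_mul] at h1 h2
    rw [h2, sum_norm_sq_col_of_mem_unitary hW] at h1
    linarith [key a]
  have hre : ∀ j, (ρ j j).re = ∑ a, p a * ‖W j a‖ ^ 2 := by
    intro j
    rw [hρ, mul_diagonal_mul_star_apply]
    simp only [mul_star_self_eq_norm_sq, ← Complex.ofReal_mul, ← Complex.ofReal_sum,
      Complex.ofReal_re]
  calc ∑ a, p a * Real.log (p a) ≤ ∑ a, p a * ∑ j, ‖W j a‖ ^ 2 * Real.log (d j) :=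
        Finset.sum_le_sum fun a _ => hlog a
    _ = ∑ j, (ρ j j).re * Real.log (d j) := by
        simp only [hre, Finset.mul_sum, Finset.sum_mul]
        rw [Finset.sum_comm]
        exact Finset.sum_congr rfl fun j _ => Finset.sum_congr rfl fun a _ => by ring

/-- A one-mode density matrix is at most `1`: `1 - A` is the adjugate of `A`, which is unitarily
equivalent to the transpose of `A`. -/
theorem IsDensity.one_sub_posSemidef {A : OneModeOp} (hA : IsDensity A) : (1 - A).PosSemidef := by
  have h := hA.posSemidef.transpose.conjTranspose_mul_mul_same (!![0, 1; -1, 0] : OneModeOp)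
  have ht := hA.trace_eq_one
  rw [Matrix.trace_fin_two] at ht
  have e : 1 - A = (!![0, 1; -1, 0] : OneModeOp).conjTranspose * A.transpose
      * (!![0, 1; -1, 0] : OneModeOp) := by
    ext i j
    fin_cases i <;> fin_cases j <;>
      simp [Matrix.mul_apply, Fin.sum_univ_two, Matrix.conjTranspose_apply]
    · linear_combination -ht
    · linear_combination -ht
  rwa [e]

theorem numOp_annM :
    numOp annM = Matrix.diagonal fun j : Occ × Occ => if j.1 = 1 then 1 else 0 := by
  ext ⟨a, b⟩ ⟨c, d⟩
  fin_cases a <;> fin_cases b <;> fin_cases c <;> fin_cases d <;>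
    simp [numOp, annM, Matrix.mul_apply]

theorem numOp_annS :
    numOp annS = Matrix.diagonal fun j : Occ × Occ => if j.2 = 1 then 1 else 0 := by
  ext ⟨a, b⟩ ⟨c, d⟩
  fin_cases a <;> fin_cases b <;> fin_cases c <;> fin_cases d <;>
    simp [numOp, annS, Matrix.mul_apply]

theorem parity_eq_diagonal :
    parity = Matrix.diagonal fun j : Occ × Occ => (if j.1 = j.2 then 1 else -1 : ℂ) := by
  rw [parity, numOp_annM, numOp_annS]
  ext ⟨a, b⟩ ⟨c, d⟩
  fin_cases a <;> fin_cases b <;> fin_cases c <;> fin_cases d <;>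
    simp [Matrix.mul_apply, Fintype.sum_prod_type, Matrix.one_apply, Matrix.diagonal_apply] <;>
    norm_num

theorem occupancy_annM (ρ : TwoModeOp) :
    occupancy annM ρ = (ρ (1, 0) (1, 0)).re + (ρ (1, 1) (1, 1)).re := by
  rw [occupancy, numOp_annM]
  simp [Matrix.trace, Matrix.diagonal_mul, Fintype.sum_prod_type]

theorem occupancy_annS (ρ : TwoModeOp) :
    occupancy annS ρ = (ρ (0, 1) (0, 1)).re + (ρ (1, 1) (1, 1)).re := by
  rw [occupancy, numOp_annS]
  simp [Matrix.trace, Matrix.diagonal_mul, Fintype.sum_prod_type]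

theorem commute_parity_iff {ρ : TwoModeOp} :
    Commute parity ρ ↔ ∀ j k : Occ × Occ, ¬ (j.1 = j.2 ↔ k.1 = k.2) → ρ j k = 0 := by
  rw [parity_eq_diagonal, Commute, SemiconjBy, ← Matrix.ext_iff]
  simp only [Matrix.diagonal_mul, Matrix.mul_diagonal]
  refine forall₂_congr fun j k => ?_
  by_cases hj : j.1 = j.2 <;> by_cases hk : k.1 = k.2 <;> simp [hj, hk, neg_eq_iff_add_eq_zero,
    eq_neg_iff_add_eq_zero, add_self_eq_zero]

/-- The diagonal of a density matrix is a probability distribution. -/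
theorem IsDensity.diag_re {n : Type*} [Fintype n] {ρ : Matrix n n ℂ} (hρ : IsDensity ρ) :
    (∀ j, 0 ≤ (ρ j j).re) ∧ ∑ j, (ρ j j).re = 1 ∧ ∀ j, ρ j j = ((ρ j j).re : ℂ) := by
  have h : ∀ j, 0 ≤ ρ j j := fun j => hρ.posSemidef.diag_nonneg
  refine ⟨fun j => (Complex.nonneg_iff.1 (h j)).1, ?_, fun j => ?_⟩
  · have := congrArg Complex.re hρ.trace_eq_one
    simpa [Matrix.trace] using this
  · exact Complex.ext rfl (by simpa using (Complex.nonneg_iff.1 (h j)).2.symm)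

/-- For a separable fermionic state, `ρ ≤ ρ_M ⊗ 1`, because every `ρ_S^k` is at most `1`; the
reduced state `ρ_M` is diagonal by the superselection rule. -/
theorem IsSeparable.le_reducedM {ρ : TwoModeOp} (hF : IsFermionicState ρ) (hS : IsSeparable ρ) :
    (Matrix.diagonal (fun j : Occ × Occ =>
      ((if j.1 = 1 then occupancy annM ρ else 1 - occupancy annM ρ : ℝ) : ℂ)) - ρ).PosSemidef := by
  obtain ⟨N, w, ρM, ρS, hw, -, hM, hSd, hρ⟩ := hS
  have hps : (∑ k, (w k : ℂ) • (ρM k ⊗ₖ (1 - ρS k))).PosSemidef :=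
    Matrix.posSemidef_sum _ fun k _ => ((hM k).posSemidef.kronecker
      (hSd k).one_sub_posSemidef).smul (by exact_mod_cast (hw k).le)
  have hred : ∀ m m' : Occ, ∑ k, (w k : ℂ) * ρM k m m' = ρ (m, 0) (m', 0) + ρ (m, 1) (m', 1) := by
    intro m m'
    simp only [hρ, Matrix.sum_apply, Matrix.smul_apply, Matrix.kroneckerMap_apply, smul_eq_mul]
    rw [← Finset.sum_add_distrib]
    refine Finset.sum_congr rfl fun k _ => ?_
    have := (hSd k).trace_eq_one
    rw [Matrix.trace_fin_two] at this
    linear_combination (-(w k : ℂ) * ρM k m m') * this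
  obtain ⟨-, hsum, hre⟩ := hF.toIsDensity.diag_re
  have hpar := commute_parity_iff.1 hF.superselection
  simp only [Fintype.sum_prod_type, Fin.sum_univ_two] at hsum
  have e1 : ((occupancy annM ρ : ℝ) : ℂ) = ρ (1, 0) (1, 0) + ρ (1, 1) (1, 1) := by
    rw [occupancy_annM, hre (1, 0), hre (1, 1)]; simp
  have e0 : ((1 - occupancy annM ρ : ℝ) : ℂ) = ρ (0, 0) (0, 0) + ρ (0, 1) (0, 1) := by
    rw [occupancy_annM, ← hsum, hre (0, 0), hre (0, 1)]; simp
  have e : Matrix.diagonal (fun j : Occ × Occ =>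
      ((if j.1 = 1 then occupancy annM ρ else 1 - occupancy annM ρ : ℝ) : ℂ)) - ρ
      = ∑ k, (w k : ℂ) • (ρM k ⊗ₖ (1 - ρS k)) := by
    ext ⟨m, s⟩ ⟨m', s'⟩
    have hR : (∑ k, (w k : ℂ) • (ρM k ⊗ₖ (1 - ρS k))) (m, s) (m', s')
        = (ρ (m, 0) (m', 0) + ρ (m, 1) (m', 1)) * (1 : OneModeOp) s s' - ρ (m, s) (m', s') := by
      rw [← hred, hρ, Finset.sum_mul]
      simp only [Matrix.sum_apply, Matrix.smul_apply, Matrix.kroneckerMap_apply, smul_eq_mul,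
        ← Finset.sum_sub_distrib, Matrix.sub_apply]
      exact Finset.sum_congr rfl fun k _ => by ring
    rw [hR, Matrix.sub_apply, sub_left_inj]
    have o1 : ρ (0, 0) (1, 0) = 0 := hpar _ _ (by simp)
    have o2 : ρ (0, 1) (1, 1) = 0 := hpar _ _ (by simp)
    have o3 : ρ (1, 0) (0, 0) = 0 := hpar _ _ (by simp)
    have o4 : ρ (1, 1) (0, 1) = 0 := hpar _ _ (by simp)
    fin_cases m <;> fin_cases m' <;> fin_cases s <;> fin_cases s' <;>
      simp [o1, o2, o3, o4, e1, ← e0]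
  rwa [e]

/-- For a separable fermionic state, `ρ ≤ 1 ⊗ ρ_S`, because every `ρ_M^k` is at most `1`; the
reduced state `ρ_S` is diagonal by the superselection rule. -/
theorem IsSeparable.le_reducedS {ρ : TwoModeOp} (hF : IsFermionicState ρ) (hS : IsSeparable ρ) :
    (Matrix.diagonal (fun j : Occ × Occ =>
      ((if j.2 = 1 then occupancy annS ρ else 1 - occupancy annS ρ : ℝ) : ℂ)) - ρ).PosSemidef := by
  obtain ⟨N, w, ρM, ρS, hw, -, hM, hSd, hρ⟩ := hS
  have hps : (∑ k, (w k : ℂ) • ((1 - ρM k) ⊗ₖ ρS k)).PosSemidef :=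
    Matrix.posSemidef_sum _ fun k _ => ((hM k).one_sub_posSemidef.kronecker
      (hSd k).posSemidef).smul (by exact_mod_cast (hw k).le)
  have hred : ∀ s s' : Occ, ∑ k, (w k : ℂ) * ρS k s s' = ρ (0, s) (0, s') + ρ (1, s) (1, s') := by
    intro s s'
    simp only [hρ, Matrix.sum_apply, Matrix.smul_apply, Matrix.kroneckerMap_apply, smul_eq_mul]
    rw [← Finset.sum_add_distrib]
    refine Finset.sum_congr rfl fun k _ => ?_
    have := (hM k).trace_eq_one
    rw [Matrix.trace_fin_two] at this
    linear_combination (-(w k : ℂ) * ρS k s s') * this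
  obtain ⟨-, hsum, hre⟩ := hF.toIsDensity.diag_re
  have hpar := commute_parity_iff.1 hF.superselection
  simp only [Fintype.sum_prod_type, Fin.sum_univ_two] at hsum
  have e1 : ((occupancy annS ρ : ℝ) : ℂ) = ρ (0, 1) (0, 1) + ρ (1, 1) (1, 1) := by
    rw [occupancy_annS, hre (0, 1), hre (1, 1)]; simp
  have e0 : ((1 - occupancy annS ρ : ℝ) : ℂ) = ρ (0, 0) (0, 0) + ρ (1, 0) (1, 0) := by
    rw [occupancy_annS, ← hsum, hre (0, 0), hre (1, 0)]; simp; ring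
  have e : Matrix.diagonal (fun j : Occ × Occ =>
      ((if j.2 = 1 then occupancy annS ρ else 1 - occupancy annS ρ : ℝ) : ℂ)) - ρ
      = ∑ k, (w k : ℂ) • ((1 - ρM k) ⊗ₖ ρS k) := by
    ext ⟨m, s⟩ ⟨m', s'⟩
    have hR : (∑ k, (w k : ℂ) • ((1 - ρM k) ⊗ₖ ρS k)) (m, s) (m', s')
        = (ρ (0, s) (0, s') + ρ (1, s) (1, s')) * (1 : OneModeOp) m m' - ρ (m, s) (m', s') := by
      rw [← hred, hρ, Finset.sum_mul]
      simp only [Matrix.sum_apply, Matrix.smul_apply, Matrix.kroneckerMap_apply, smul_eq_mul,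
        ← Finset.sum_sub_distrib, Matrix.sub_apply]
      exact Finset.sum_congr rfl fun k _ => by ring
    rw [hR, Matrix.sub_apply, sub_left_inj]
    have o1 : ρ (0, 0) (0, 1) = 0 := hpar _ _ (by simp)
    have o2 : ρ (1, 0) (1, 1) = 0 := hpar _ _ (by simp)
    have o3 : ρ (0, 1) (0, 0) = 0 := hpar _ _ (by simp)
    have o4 : ρ (1, 1) (1, 0) = 0 := hpar _ _ (by simp)
    fin_cases m <;> fin_cases m' <;> fin_cases s <;> fin_cases s' <;>
      simp [o1, o2, o3, o4, e1, ← e0]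
  rwa [e]

/-- The von Neumann entropy of a separable fermionic state, with eigenvalues `p`, is at least the
entropy of either mode. -/
theorem IsSeparable.max_binEntropy_le {ρ W : TwoModeOp} {p : Occ × Occ → ℝ}
    (hF : IsFermionicState ρ) (hS : IsSeparable ρ) (hW : W ∈ unitary TwoModeOp)
    (hp : ∀ a, 0 ≤ p a) (hp1 : ∑ a, p a = 1)
    (hρ : ρ = W * Matrix.diagonal (fun a => (p a : ℂ)) * star W) :
    max (Real.binEntropy (occupancy annS ρ)) (Real.binEntropy (occupancy annM ρ))
      ≤ -∑ a, p a * Real.log (p a) := by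
  obtain ⟨hnn, hsum, -⟩ := hF.toIsDensity.diag_re
  simp only [Fintype.sum_prod_type, Fin.sum_univ_two] at hsum
  have hnonneg : 0 ≤ -∑ a, p a * Real.log (p a) := by
    rw [← Finset.sum_neg_distrib]
    refine Finset.sum_nonneg fun a _ => ?_
    have h1 : p a ≤ 1 := hp1 ▸ Finset.single_le_sum (fun b _ => hp b) (Finset.mem_univ a)
    exact neg_nonneg.2 (mul_nonpos_of_nonneg_of_nonpos (hp a) (Real.log_nonpos (hp a) h1))
  have h00 := hnn (0, 0)
  have h01 := hnn (0, 1)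
  have h10 := hnn (1, 0)
  have h11 := hnn (1, 1)
  refine max_le ?_ ?_
  · -- a mode in a pure state has zero entropy; otherwise the reduced state is invertible
    have hn := occupancy_annS ρ
    rcases eq_or_ne (occupancy annS ρ) 0 with h0 | h0
    · rw [h0, Real.binEntropy_zero]; exact hnonneg
    rcases eq_or_ne (occupancy annS ρ) 1 with h1 | h1
    · rw [h1, Real.binEntropy_one]; exact hnonneg
    have g0 : 0 < occupancy annS ρ := lt_of_le_of_ne (by linarith) h0.symm
    have g1 : 0 < 1 - occupancy annS ρ := sub_pos.2 (lt_of_le_of_ne (by linarith) h1)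
    have h := sum_mul_log_le_of_le_diagonal hW hp hρ
      (fun j => by split_ifs <;> assumption) (hS.le_reducedS hF)
    simp only [Fintype.sum_prod_type, Fin.sum_univ_two] at h ⊢
    rw [Real.binEntropy, Real.log_inv, Real.log_inv]
    simp only [zero_ne_one, if_true, if_false] at h
    have e : 1 - occupancy annS ρ = (ρ (0, 0) (0, 0)).re + (ρ (1, 0) (1, 0)).re := by linarith
    linear_combination h - Real.log (occupancy annS ρ) * hn - Real.log (1 - occupancy annS ρ) * e
  · have hn := occupancy_annM ρ
    rcases eq_or_ne (occupancy annM ρ) 0 with h0 | h0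
    · rw [h0, Real.binEntropy_zero]; exact hnonneg
    rcases eq_or_ne (occupancy annM ρ) 1 with h1 | h1
    · rw [h1, Real.binEntropy_one]; exact hnonneg
    have g0 : 0 < occupancy annM ρ := lt_of_le_of_ne (by linarith) h0.symm
    have g1 : 0 < 1 - occupancy annM ρ := sub_pos.2 (lt_of_le_of_ne (by linarith) h1)
    have h := sum_mul_log_le_of_le_diagonal hW hp hρ
      (fun j => by split_ifs <;> assumption) (hS.le_reducedM hF)
    simp only [Fintype.sum_prod_type, Fin.sum_univ_two] at h ⊢
    rw [Real.binEntropy, Real.log_inv, Real.log_inv]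
    simp only [zero_ne_one, if_true, if_false] at h
    have e : 1 - occupancy annM ρ = (ρ (0, 0) (0, 0)).re + (ρ (0, 1) (0, 1)).re := by linarith
    linear_combination h - Real.log (occupancy annM ρ) * hn - Real.log (1 - occupancy annM ρ) * e

/-! ### Product bases of the global Hilbert space -/

theorem hasSum_prod_of_fintype {A ι E : Type*} [Fintype A] [AddCommMonoid E] [TopologicalSpace E]
    [ContinuousAdd E] {f : A × ι → E} {s : A → E}
    (h : ∀ a, HasSum (fun i => f (a, i)) (s a)) : HasSum f (∑ a, s a) := by
  classical
  have h1 : ∀ a, HasSum (fun x : A × ι => if x.1 = a then f x else 0) (s a) := by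
    intro a
    refine ((Prod.mk_right_injective a).hasSum_iff ?_).1 ?_
    · rintro ⟨a', i⟩ hx
      have : a' ≠ a := fun e => hx ⟨i, by rw [e]⟩
      simp [this]
    · simpa [Function.comp_def] using h a
  have h2 := hasSum_sum (s := Finset.univ) fun a _ => h1 a
  simpa using h2

theorem hasSum_prod_of_fintype_of_nonneg {A ι : Type*} [Fintype A] {f : A × ι → ℝ} {s : ℝ}
    (hf : ∀ x, 0 ≤ f x) (h : HasSum (fun i => ∑ a, f (a, i)) s) : HasSum f s := by
  have h1 : ∀ a, Summable fun i => f (a, i) := fun a =>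
    Summable.of_nonneg_of_le (fun i => hf _)
      (fun i => Finset.single_le_sum (f := fun a => f (a, i)) (fun b _ => hf _)
        (Finset.mem_univ a)) h.summable
  have h2 := hasSum_prod_of_fintype fun a => (h1 a).hasSum
  rwa [(hasSum_sum (s := Finset.univ) fun a _ => (h1 a).hasSum).unique h] at h2

section Parseval

variable {ι K : Type*} [NormedAddCommGroup K] [InnerProductSpace ℂ K]

/-- The vector `w_a ⊗ b_i`, where `w_a` is the column `a` of `W`. -/
def productVector (b : HilbertBasis ι ℂ K) (W : TwoModeOp) (x : (Occ × Occ) × ι) : Global K :=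
  WithLp.toLp 2 fun j => W j x.1 • b x.2

theorem inner_productVector (b : HilbertBasis ι ℂ K) (W : TwoModeOp) (x : (Occ × Occ) × ι)
    (w : Global K) :
    ⟪productVector b W x, w⟫_ℂ = ∑ j, star (W j x.1) * ⟪b x.2, w j⟫_ℂ := by
  simp [PiLp.inner_apply, productVector, inner_smul_left]

theorem norm_productVector (b : HilbertBasis ι ℂ K) {W : TwoModeOp} (hW : W ∈ unitary TwoModeOp)
    (x : (Occ × Occ) × ι) : ‖productVector b W x‖ ^ 2 = 1 := by
  rw [PiLp.norm_sq_eq_of_L2, ← sum_norm_sq_col_of_mem_unitary hW x.1]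
  simp [productVector, norm_smul, b.orthonormal.1]

theorem sum_norm_sq_star_mulVec {n : Type*} [Fintype n] [DecidableEq n] {W : Matrix n n ℂ}
    (hW : W ∈ unitary (Matrix n n ℂ)) (c : n → ℂ) :
    ∑ a, ‖∑ j, star (W j a) * c j‖ ^ 2 = ∑ j, ‖c j‖ ^ 2 := by
  have h : star (Matrix.mulVec (star W) c) ⬝ᵥ Matrix.mulVec (star W) c = star c ⬝ᵥ c := by
    rw [Matrix.star_mulVec, ← Matrix.star_eq_conjTranspose, star_star, Matrix.dotProduct_mulVec,
      Matrix.vecMul_vecMul, Unitary.mul_star_self_of_mem hW, Matrix.vecMul_one]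
  simp only [dotProduct, Matrix.mulVec, Matrix.star_apply, Pi.star_apply,
    mul_comm (star _) (Finset.sum _ _), mul_comm (star (c _)) (c _), mul_star_self_eq_norm_sq] at h
  exact_mod_cast h

/-- Parseval's identity for a product basis. -/
theorem hasSum_norm_sq_inner_productVector (b : HilbertBasis ι ℂ K) {W : TwoModeOp}
    (hW : W ∈ unitary TwoModeOp) (w : Global K) :
    HasSum (fun x => ‖⟪productVector b W x, w⟫_ℂ‖ ^ 2) (‖w‖ ^ 2) := by
  refine hasSum_prod_of_fintype_of_nonneg (fun _ => sq_nonneg _) ?_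
  simp only [inner_productVector]
  simp only [sum_norm_sq_star_mulVec hW, PiLp.norm_sq_eq_of_L2]
  refine hasSum_sum fun j _ => ?_
  have h := b.hasSum_inner_mul_inner (w j) (w j)
  rw [inner_self_eq_norm_sq_to_K] at h
  have h2 : ∀ i, ⟪w j, b i⟫_ℂ * ⟪b i, w j⟫_ℂ = ((‖⟪b i, w j⟫_ℂ‖ ^ 2 : ℝ) : ℂ) := by
    intro i
    rw [← mul_star_self_eq_norm_sq, mul_comm, ← inner_conj_symm (w j) (b i)]
    rfl
  simp only [h2] at h
  exact Complex.hasSum_ofReal.1 (by simpa using h)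

end Parseval

/-! ### The Gibbs state -/

section Gibbs

variable {ι K : Type*} [NormedAddCommGroup K] [InnerProductSpace ℂ K]

theorem nonempty_of_hilbertBasis [Nontrivial K] (b : HilbertBasis ι ℂ K) : Nonempty ι := by
  by_contra hι
  rw [not_nonempty_iff] at hι
  obtain ⟨x, hx⟩ := exists_ne (0 : K)
  exact hx ((b.hasSum_repr x).unique hasSum_empty)

namespace Reservoir

/-- The eigenvalue `exp (-β Eᵢ) / Tr exp (-β H_R)` of the Gibbs state. -/
def gibbsWeight (R : Reservoir ι K) (β : ℝ) (i : ι) : ℝ :=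
  Real.exp (-β * R.energy i) / R.partitionFunction β

variable {R : Reservoir ι K} {β : ℝ}

theorem partitionFunction_pos [Nontrivial K] (hZ : R.HasPartitionFunction β) :
    0 < R.partitionFunction β := by
  obtain ⟨i⟩ := nonempty_of_hilbertBasis R.basis
  exact hZ.tsum_pos (fun _ => (Real.exp_pos _).le) i (Real.exp_pos _)

theorem gibbsWeight_pos [Nontrivial K] (hZ : R.HasPartitionFunction β) (i : ι) :
    0 < R.gibbsWeight β i :=
  div_pos (Real.exp_pos _) (partitionFunction_pos hZ)

theorem hasSum_gibbsWeight [Nontrivial K] (hZ : R.HasPartitionFunction β) :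
    HasSum (R.gibbsWeight β) 1 := by
  have h := hZ.hasSum.div_const (R.partitionFunction β)
  have h1 : (∑' i, Real.exp (-β * R.energy i)) / R.partitionFunction β = 1 :=
    div_self (partitionFunction_pos hZ).ne'
  rwa [h1] at h

theorem log_gibbsWeight [Nontrivial K] (hZ : R.HasPartitionFunction β) (i : ι) :
    Real.log (R.gibbsWeight β i) = -β * R.energy i - Real.log (R.partitionFunction β) := by
  rw [gibbsWeight, Real.log_div (Real.exp_pos _).ne' (partitionFunction_pos hZ).ne', Real.log_exp]

/-- The cross entropy of a joint distribution `q` relative to the product of `m` with the Gibbs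
distribution is, up to the constant `log Z`, the cross entropy of the marginal `Q` relative to `m`
plus `β` times the mean energy. -/
theorem hasSum_mul_log_mul_gibbsWeight [Nontrivial K] (hZ : R.HasPartitionFunction β) {A : Type*}
    [Fintype A] {q : A × ι → ℝ} {Q m : A → ℝ} (hq : ∀ y, 0 ≤ q y)
    (hQ : ∀ a, HasSum (fun i => q (a, i)) (Q a)) (hQ1 : ∑ a, Q a = 1)
    (hm : ∀ a, m a = 0 → Q a = 0)
    (hE : Summable fun i => R.energy i * ∑ a, q (a, i)) :
    HasSum (fun y => q y * Real.log (m y.1 * R.gibbsWeight β y.2))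
      (∑ a, Q a * Real.log (m a) - β * ∑' i, R.energy i * ∑ a, q (a, i)
        - Real.log (R.partitionFunction β)) := by
  have hle : ∀ a i, q (a, i) ≤ ∑ a, q (a, i) := fun a i =>
    Finset.single_le_sum (f := fun a => q (a, i)) (fun b _ => hq _) (Finset.mem_univ a)
  have hEa : ∀ a, Summable fun i => R.energy i * q (a, i) := by
    intro a
    refine Summable.of_norm_bounded hE.norm fun i => ?_
    rw [norm_mul, norm_mul]
    refine mul_le_mul_of_nonneg_left ?_ (norm_nonneg _)
    rw [Real.norm_of_nonneg (hq _), Real.norm_of_nonneg ((hq _).trans (hle a i))]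
    exact hle a i
  have hEsum : ∑ a, ∑' i, R.energy i * q (a, i) = ∑' i, R.energy i * ∑ a, q (a, i) := by
    rw [← Summable.tsum_finsetSum fun a _ => hEa a]
    simp only [Finset.mul_sum]
  have h1 : HasSum (fun y => q y * Real.log (m y.1 * R.gibbsWeight β y.2))
      (∑ a, (Q a * Real.log (m a) - β * ∑' i, R.energy i * q (a, i)
        - Q a * Real.log (R.partitionFunction β))) := by
    refine hasSum_prod_of_fintype fun a => ?_
    refine ((((hQ a).mul_right (Real.log (m a))).sub ((hEa a).hasSum.mul_left β)).sub
      ((hQ a).mul_right (Real.log (R.partitionFunction β)))).congr_fun fun i => ?_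
    by_cases ha : m a = 0
    · have h0 := (hasSum_zero_iff_of_nonneg fun i => hq (a, i)).1 (hm a ha ▸ hQ a)
      have : q (a, i) = 0 := congrFun h0 i
      simp [this]
    · rw [Real.log_mul ha (gibbsWeight_pos hZ i).ne', log_gibbsWeight hZ]
      ring
  convert h1 using 1
  rw [Finset.sum_sub_distrib, Finset.sum_sub_distrib, ← Finset.mul_sum, ← Finset.sum_mul, hQ1,
    hEsum, one_mul]

variable [CompleteSpace K]

theorem hasSum_gibbs [Nontrivial K] (hZ : R.HasPartitionFunction β) :
    HasSum (fun i => ((R.gibbsWeight β i : ℝ) : ℂ) •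
      InnerProductSpace.rankOne ℂ (R.basis i) (R.basis i)) (R.gibbs β) := by
  refine Summable.hasSum (Summable.of_norm ?_)
  refine (hasSum_gibbsWeight hZ).summable.congr fun i => ?_
  rw [norm_smul, InnerProductSpace.norm_rankOne, R.basis.orthonormal.1, Complex.norm_real,
    Real.norm_of_nonneg (gibbsWeight_pos hZ i).le]
  simp

theorem hasSum_inner_gibbs [Nontrivial K] (hZ : R.HasPartitionFunction β) (x y : K) :
    HasSum (fun i => (R.gibbsWeight β i : ℂ) * (⟪x, R.basis i⟫_ℂ * ⟪R.basis i, y⟫_ℂ))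
      ⟪x, R.gibbs β y⟫_ℂ := by
  have h := ((hasSum_gibbs hZ).mapL (ContinuousLinearMap.apply ℂ K y)).mapL (innerSL ℂ x)
  simpa [mul_comm ⟪x, R.basis _⟫_ℂ, inner_smul_right] using h

theorem gibbs_basis [Nontrivial K] (hZ : R.HasPartitionFunction β) (i : ι) :
    R.gibbs β (R.basis i) = (R.gibbsWeight β i : ℂ) • R.basis i := by
  classical
  have h := (hasSum_gibbs hZ).mapL (ContinuousLinearMap.apply ℂ K (R.basis i))
  refine h.unique ?_
  convert hasSum_ite_eq i ((R.gibbsWeight β i : ℂ) • R.basis i) using 2 with k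
  split_ifs with hk
  · subst hk
    simp [R.basis.orthonormal.1]
  · simp [R.basis.orthonormal.2 hk]

theorem inner_gibbs_basis [Nontrivial K] (hZ : R.HasPartitionFunction β) (i : ι) :
    ⟪R.basis i, R.gibbs β (R.basis i)⟫_ℂ = (R.gibbsWeight β i : ℂ) := by
  rw [gibbs_basis hZ, inner_smul_right, inner_self_eq_norm_sq_to_K, R.basis.orthonormal.1]
  simp

end Reservoir

end Gibbs

/-! ### Matrix elements of tensor products and partial traces -/

section Operators

variable {ι K : Type*} [NormedAddCommGroup K] [InnerProductSpace ℂ K]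

@[simp] theorem component_apply (j : Occ × Occ) (w : Global K) : component K j w = w j := rfl

variable [CompleteSpace K]

theorem component_adjoint_apply (k : Occ × Occ) (x : K) :
    (component K k).adjoint x = WithLp.toLp 2 (Pi.single k x) := by
  refine ext_inner_left ℂ fun v => ?_
  rw [ContinuousLinearMap.adjoint_inner_right, PiLp.inner_apply]
  rw [Finset.sum_eq_single k]
  · simp
  · intro j _ hj
    simp [hj]
  · simp

theorem component_adjoint_basis (b : HilbertBasis ι ℂ K) (y : (Occ × Occ) × ι) :
    (component K y.1).adjoint (b y.2) = productVector b 1 y := by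
  rw [component_adjoint_apply]
  ext j
  by_cases h : j = y.1
  · subst h; simp [productVector]
  · simp [productVector, h, Matrix.one_apply]

theorem tensorOp_apply (A : TwoModeOp) (T : K →L[ℂ] K) (w : Global K) (j : Occ × Occ) :
    tensorOp A T w j = ∑ k, A j k • T (w k) := by
  have h : ∀ l k : Occ × Occ,
      ((component K l).adjoint (T (w k))) j = if j = l then T (w k) else 0 := by
    intro l k
    rw [component_adjoint_apply]
    by_cases hjl : j = l
    · subst hjl; simp
    · simp [hjl]
  simp [tensorOp, h]

theorem inner_tensorOp (A : TwoModeOp) (T : K →L[ℂ] K) (v w : Global K) :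
    ⟪v, tensorOp A T w⟫_ℂ = ∑ j, ∑ k, A j k * ⟪v j, T (w k)⟫_ℂ := by
  simp [PiLp.inner_apply, tensorOp_apply, inner_sum, inner_smul_right]

theorem inner_block (F : Global K →L[ℂ] Global K) (j k : Occ × Occ) (x y : K) :
    ⟪x, block F j k y⟫_ℂ = ⟪(component K j).adjoint x, F ((component K k).adjoint y)⟫_ℂ := by
  simp [block, ContinuousLinearMap.adjoint_inner_left]

theorem Reservoir.inner_finalState (R : Reservoir ι K) (β : ℝ) (ρ : TwoModeOp)
    (U : Global K →L[ℂ] Global K) (v : Global K) :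
    ⟪v, R.finalState β ρ U v⟫_ℂ = ⟪star U v, tensorOp ρ (R.gibbs β) (star U v)⟫_ℂ := by
  rw [ContinuousLinearMap.star_eq_adjoint, ContinuousLinearMap.adjoint_inner_left]
  rfl

/-- The expectation value of `ρ ⊗ ρ_R^eq` in the product eigenbasis. -/
theorem Reservoir.hasSum_inner_tensorOp_gibbs [Nontrivial K] {R : Reservoir ι K} {β : ℝ}
    (hZ : R.HasPartitionFunction β) {ρ W : TwoModeOp} {p : Occ × Occ → ℝ} (hp : ∀ a, 0 ≤ p a)
    (hρ : ρ = W * Matrix.diagonal (fun a => (p a : ℂ)) * star W) (w : Global K) :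
    HasSum (fun x : (Occ × Occ) × ι =>
        p x.1 * R.gibbsWeight β x.2 * ‖⟪productVector R.basis W x, w⟫_ℂ‖ ^ 2)
      (⟪w, tensorOp ρ (R.gibbs β) w⟫_ℂ).re ∧ (⟪w, tensorOp ρ (R.gibbs β) w⟫_ℂ).im = 0 := by
  have h : HasSum (fun i => ∑ j, ∑ k, ρ j k * ((R.gibbsWeight β i : ℂ) *
      (⟪w j, R.basis i⟫_ℂ * ⟪R.basis i, w k⟫_ℂ))) ⟪w, tensorOp ρ (R.gibbs β) w⟫_ℂ := by
    rw [inner_tensorOp]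
    exact hasSum_sum fun j _ => hasSum_sum fun k _ => (hasSum_inner_gibbs hZ _ _).mul_left _
  have e : ∀ i, ∑ j, ∑ k, ρ j k * ((R.gibbsWeight β i : ℂ) *
      (⟪w j, R.basis i⟫_ℂ * ⟪R.basis i, w k⟫_ℂ)) =
      ((∑ a, p a * R.gibbsWeight β i * ‖⟪productVector R.basis W (a, i), w⟫_ℂ‖ ^ 2 : ℝ) : ℂ) := by
    intro i
    push_cast
    have e1 : ∀ a, (‖⟪productVector R.basis W (a, i), w⟫_ℂ‖ : ℂ) ^ 2
        = ∑ j, ∑ k, (W j a * ⟪w j, R.basis i⟫_ℂ) * (star (W k a) * ⟪R.basis i, w k⟫_ℂ) := by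
      intro a
      rw [← Complex.ofReal_pow, ← mul_star_self_eq_norm_sq, inner_productVector, star_sum, mul_comm,
        Finset.sum_mul_sum]
      refine Finset.sum_congr rfl fun j _ => Finset.sum_congr rfl fun k _ => ?_
      rw [star_mul', star_star, ← inner_conj_symm (w j) (R.basis i)]
      rfl
    simp only [e1, Finset.mul_sum]
    conv_rhs => rw [Finset.sum_comm]
    refine Finset.sum_congr rfl fun j _ => ?_
    conv_rhs => rw [Finset.sum_comm]
    refine Finset.sum_congr rfl fun k _ => ?_
    rw [hρ, mul_diagonal_mul_star_apply, Finset.sum_mul]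
    exact Finset.sum_congr rfl fun a _ => by ring
  simp only [e] at h
  refine ⟨hasSum_prod_of_fintype_of_nonneg (fun x => ?_) ?_, ?_⟩
  · exact mul_nonneg (mul_nonneg (hp _) (gibbsWeight_pos hZ _).le) (sq_nonneg _)
  · simpa only [Complex.ofReal_re] using Complex.hasSum_re h
  · exact (Complex.hasSum_im h).unique (by simpa only [Complex.ofReal_im] using hasSum_zero)

end Operators

/-! ### The entropy balance of a process -/

/-- Subadditivity for classical distributions of two occupation numbers: the cross entropy of `Q`
relative to the product of its marginals. -/
theorem sum_mul_log_marginals {Q : Occ × Occ → ℝ} (hQ : ∀ j, 0 ≤ Q j) (hQ1 : ∑ j, Q j = 1)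
    {nM nS : ℝ} (hM : nM = Q (1, 0) + Q (1, 1)) (hS : nS = Q (0, 1) + Q (1, 1)) :
    (∀ j : Occ × Occ, 0 ≤ (if j.1 = 1 then nM else 1 - nM) * (if j.2 = 1 then nS else 1 - nS)) ∧
    (∀ j : Occ × Occ,
      (if j.1 = 1 then nM else 1 - nM) * (if j.2 = 1 then nS else 1 - nS) = 0 → Q j = 0) ∧
    ∑ j : Occ × Occ, Q j *
        Real.log ((if j.1 = 1 then nM else 1 - nM) * (if j.2 = 1 then nS else 1 - nS))
      = -(Real.binEntropy nS + Real.binEntropy nM) := by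
  simp only [Fintype.sum_prod_type, Fin.sum_univ_two] at hQ1
  have h00 := hQ (0, 0)
  have h01 := hQ (0, 1)
  have h10 := hQ (1, 0)
  have h11 := hQ (1, 1)
  have leM : ∀ j : Occ × Occ, Q j ≤ if j.1 = 1 then nM else 1 - nM := by
    rintro ⟨m, s⟩
    fin_cases m <;> fin_cases s <;> simp <;> linarith
  have leS : ∀ j : Occ × Occ, Q j ≤ if j.2 = 1 then nS else 1 - nS := by
    rintro ⟨m, s⟩
    fin_cases m <;> fin_cases s <;> simp <;> linarith
  refine ⟨fun j => mul_nonneg ((hQ j).trans (leM j)) ((hQ j).trans (leS j)), fun j hj => ?_, ?_⟩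
  · rcases mul_eq_zero.1 hj with h | h
    · exact le_antisymm (h ▸ leM j) (hQ j)
    · exact le_antisymm (h ▸ leS j) (hQ j)
  · have h : ∀ j : Occ × Occ, Q j *
        Real.log ((if j.1 = 1 then nM else 1 - nM) * (if j.2 = 1 then nS else 1 - nS))
        = Q j * Real.log (if j.1 = 1 then nM else 1 - nM)
          + Q j * Real.log (if j.2 = 1 then nS else 1 - nS) := by
      intro j
      rcases (hQ j).eq_or_lt with h0 | h0
      · simp [← h0]
      · rw [Real.log_mul (h0.trans_le (leM j)).ne' (h0.trans_le (leS j)).ne', mul_add]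
    simp only [h, Fintype.sum_prod_type, Fin.sum_univ_two, zero_ne_one, if_true, if_false,
      Real.binEntropy, Real.log_inv]
    have hM' : 1 - nM = Q (0, 0) + Q (0, 1) := by linarith
    have hS' : 1 - nS = Q (0, 0) + Q (1, 0) := by linarith
    linear_combination -Real.log nM * hM - Real.log nS * hS - Real.log (1 - nM) * hM'
      - Real.log (1 - nS) * hS'

variable {ι K : Type*} [NormedAddCommGroup K] [InnerProductSpace ℂ K] [CompleteSpace K]

theorem norm_sq_apply_of_star_mul_self {E : Type*} [NormedAddCommGroup E] [InnerProductSpace ℂ E]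
    [CompleteSpace E] {U : E →L[ℂ] E} (hU : star U * U = 1) (w : E) : ‖U w‖ ^ 2 = ‖w‖ ^ 2 := by
  have h : ⟪U w, U w⟫_ℂ = ⟪w, w⟫_ℂ := by
    rw [← ContinuousLinearMap.adjoint_inner_right, ← ContinuousLinearMap.star_eq_adjoint,
      ← mul_apply_eq_comp, hU, one_apply_eq_self]
  rw [← inner_self_eq_norm_sq (𝕜 := ℂ), h, inner_self_eq_norm_sq]

/-- The entropy balance of a process: with the eigenvalues `p` of the initial two-mode state, the
von Neumann entropy `-∑ p log p` is at most the sum of the final mode entropies minus `β Q`.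
This is Klein's inequality for the final global state relative to the product of its two one-mode
marginals with the Gibbs state. As that reference state is diagonal in the product of the occupation
basis and the eigenbasis of `H_R`, the inequality reduces to the one for the doubly stochastic
kernel of transition probabilities from the initial to the reference eigenbasis. -/
theorem Reservoir.entropy_le [Nontrivial K] {R : Reservoir ι K} {β : ℝ}
    (hZ : R.HasPartitionFunction β) (hE : R.HasFiniteEnergy (R.gibbs β))
    {ρ W : TwoModeOp} {p : Occ × Occ → ℝ} (hW : W ∈ unitary TwoModeOp) (hp : ∀ a, 0 ≤ p a)
    (hp1 : ∑ a, p a = 1) (hρ : ρ = W * Matrix.diagonal (fun a => (p a : ℂ)) * star W)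
    {U : Global K →L[ℂ] Global K} (hU : U ∈ unitary (Global K →L[ℂ] Global K))
    (hE1 : R.HasFiniteEnergy (reducedR (R.finalState β ρ U))) :
    -∑ a, p a * Real.log (p a)
      ≤ Real.binEntropy (occupancy annS (reducedMS R.basis (R.finalState β ρ U)))
        + Real.binEntropy (occupancy annM (reducedMS R.basis (R.finalState β ρ U)))
        - β * R.heat β ρ U := by
  set F := R.finalState β ρ U
  -- the transition probabilities, and the diagonal `q` of the final state
  set D : (Occ × Occ) × ι → (Occ × Occ) × ι → ℝ := fun x y =>
    ‖⟪productVector R.basis W x, star U (productVector R.basis 1 y)⟫_ℂ‖ ^ 2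
  set q : (Occ × Occ) × ι → ℝ := fun y => (⟪R.basis y.2, block F y.1 y.1 (R.basis y.2)⟫_ℂ).re
  have hone : (1 : TwoModeOp) ∈ unitary TwoModeOp := one_mem _
  have hg := hasSum_gibbsWeight hZ
  have hD : ∀ x y, 0 ≤ D x y := fun _ _ => sq_nonneg _
  have hrow : ∀ x, HasSum (fun y => D x y) 1 := by
    intro x
    have h := hasSum_norm_sq_inner_productVector R.basis hone (U (productVector R.basis W x))
    rw [norm_sq_apply_of_star_mul_self (Unitary.star_mul_self_of_mem hU),
      norm_productVector R.basis hW] at h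
    convert h using 3 with y
    rw [ContinuousLinearMap.star_eq_adjoint, ContinuousLinearMap.adjoint_inner_right,
      norm_inner_symm]
  have hcol : ∀ y, HasSum (fun x => D x y) 1 := by
    intro y
    have h := hasSum_norm_sq_inner_productVector R.basis hW (star U (productVector R.basis 1 y))
    rwa [norm_sq_apply_of_star_mul_self (by rw [star_star]; exact Unitary.mul_star_self_of_mem hU),
      norm_productVector R.basis hone] at h
  have hblock : ∀ y : (Occ × Occ) × ι, ⟪R.basis y.2, block F y.1 y.1 (R.basis y.2)⟫_ℂ
      = ⟪star U (productVector R.basis 1 y),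
          tensorOp ρ (R.gibbs β) (star U (productVector R.basis 1 y))⟫_ℂ := by
    intro y
    rw [inner_block, component_adjoint_basis, inner_finalState]
  have hq : ∀ y, HasSum (fun x : (Occ × Occ) × ι => p x.1 * R.gibbsWeight β x.2 * D x y) (q y) := by
    intro y
    have h := (hasSum_inner_tensorOp_gibbs hZ hp hρ (star U (productVector R.basis 1 y))).1
    rwa [← hblock] at h
  have him : ∀ j i, ⟪R.basis i, block F j j (R.basis i)⟫_ℂ = (q (j, i) : ℂ) := by
    intro j i
    have h := (hasSum_inner_tensorOp_gibbs hZ hp hρ (star U (productVector R.basis 1 (j, i)))).2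
    rw [← hblock] at h
    exact Complex.ext rfl (by simpa using h)
  have hpg : ∀ x : (Occ × Occ) × ι, 0 ≤ p x.1 * R.gibbsWeight β x.2 := fun x =>
    mul_nonneg (hp _) (gibbsWeight_pos hZ _).le
  have hq0 : ∀ y, 0 ≤ q y := fun y => (hq y).nonneg fun x => mul_nonneg (hpg x) (hD x y)
  have hprow : ∀ a, HasSum (fun i => p a * R.gibbsWeight β i) (p a) := fun a => by
    simpa using hg.mul_left (p a)
  have hpg1 : HasSum (fun x : (Occ × Occ) × ι => p x.1 * R.gibbsWeight β x.2) 1 :=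
    hp1 ▸ hasSum_prod_of_fintype hprow
  have hqsum : HasSum q 1 := hasSum_of_rowSum_eq_one hD hrow hpg1 hq
  -- the marginal of `q` on the two modes
  set Q : Occ × Occ → ℝ := fun j => ∑' i, q (j, i)
  have hQ : ∀ j, HasSum (fun i => q (j, i)) (Q j) := fun j =>
    (hqsum.summable.comp_injective (Prod.mk_right_injective j)).hasSum
  have hQ1 : ∑ j, Q j = 1 := (hasSum_prod_of_fintype hQ).unique hqsum
  have hMS : ∀ j, (reducedMS R.basis F j j).re = Q j := by
    intro j
    have h : HasSum (fun i => ⟪R.basis i, block F j j (R.basis i)⟫_ℂ) (Q j : ℂ) := by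
      simp only [him]
      exact Complex.hasSum_ofReal.2 (hQ j)
    rw [reducedMS, h.tsum_eq, Complex.ofReal_re]
  have hnM := occupancy_annM (reducedMS R.basis F)
  have hnS := occupancy_annS (reducedMS R.basis F)
  simp only [hMS] at hnM hnS
  -- the reference state `m`, the product of the one-mode marginals of `Q`
  obtain ⟨hm0, hmQ, hlog⟩ := sum_mul_log_marginals
    (fun j => (hQ j).nonneg fun i => hq0 _) hQ1 hnM hnS
  set nM := occupancy annM (reducedMS R.basis F)
  set nS := occupancy annS (reducedMS R.basis F)
  set m : Occ × Occ → ℝ := fun j =>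
    (if j.1 = 1 then nM else 1 - nM) * (if j.2 = 1 then nS else 1 - nS)
  -- the energies
  have hR : ∀ i, (⟪R.basis i, reducedR F (R.basis i)⟫_ℂ).re = ∑ j, q (j, i) := by
    intro i
    simp [reducedR, q]
  have hEf : Summable fun i => R.energy i * ∑ j, q (j, i) := by
    simpa only [HasFiniteEnergy, hR] using hE1
  have hEg : Summable fun i => R.energy i * ∑ a, p a * R.gibbsWeight β i := by
    simp only [← Finset.sum_mul, hp1, one_mul]
    simpa only [HasFiniteEnergy, inner_gibbs_basis hZ, Complex.ofReal_re] using hE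
  have hf := hasSum_mul_log_mul_gibbsWeight (m := m) hZ hq0 hQ hQ1 hmQ hEf
  have hi := hasSum_mul_log_mul_gibbsWeight (m := p) hZ hpg hprow hp1 (fun _ h => h) hEg
  have hr1 : HasSum (fun y : (Occ × Occ) × ι => m y.1 * R.gibbsWeight β y.2) 1 := by
    have h : ∑ j, m j = 1 := by
      simp only [m, Fintype.sum_prod_type, Fin.sum_univ_two, zero_ne_one, if_true, if_false]
      ring
    refine h ▸ hasSum_prod_of_fintype fun j => ?_
    simpa using hg.mul_left (m j)
  have hklein := tsum_mul_log_le_of_doublyStochastic hD hrow hcol hpg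
    (fun y => mul_nonneg (hm0 y.1) (gibbsWeight_pos hZ y.2).le) hpg1 hr1 hq
    (fun y hy => by
      have h0 := (mul_eq_zero.1 hy).resolve_right (gibbsWeight_pos hZ y.2).ne'
      exact congrFun ((hasSum_zero_iff_of_nonneg fun i => hq0 (y.1, i)).1
        (hmQ y.1 h0 ▸ hQ y.1)) y.2)
    hi.summable hf.summable
  rw [hf.tsum_eq, hi.tsum_eq, hlog] at hklein
  simp only [← Finset.sum_mul, hp1, one_mul] at hklein
  have hheat : R.heat β ρ U
      = -(∑' i, R.energy i * ∑ j, q (j, i) - ∑' i, R.energy i * R.gibbsWeight β i) := by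
    rw [heat, meanEnergy, meanEnergy]
    simp only [inner_gibbs_basis hZ, Complex.ofReal_re]
    rw [← tsum_congr fun i => congrArg (R.energy i * ·) (hR i)]
  rw [hheat]
  linarith

/-- A separable state has at least as much entropy as either mode, and no process can account for
more entropy than the final modes and the heat provide. -/
theorem Reservoir.witness_nonneg [Nontrivial K] {R : Reservoir ι K} {β : ℝ}
    (hZ : R.HasPartitionFunction β) (hE : R.HasFiniteEnergy (R.gibbs β)) {ρ : TwoModeOp}
    (hF : IsFermionicState ρ) (hS : IsSeparable ρ)
    {U : Global K →L[ℂ] Global K} (hU : U ∈ unitary (Global K →L[ℂ] Global K))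
    (hE1 : R.HasFiniteEnergy (reducedR (R.finalState β ρ U))) : 0 ≤ R.witness β ρ U := by
  obtain ⟨p, W, hW, hp, hp1, hρ⟩ := hF.toIsDensity.exists_spectral
  have h1 := hS.max_binEntropy_le hF hW hp hp1 hρ
  have h2 := entropy_le hZ hE hW hp hp1 hρ hU hE1
  rw [witness]
  linarith

/-! ### The isolated reservoir -/

section Isolated

variable {ι K : Type*} [NormedAddCommGroup K] [InnerProductSpace ℂ K] [CompleteSpace K]

theorem tensorOp_mul (A B : TwoModeOp) (S T : K →L[ℂ] K) :
    tensorOp A S * tensorOp B T = tensorOp (A * B) (S * T) := by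
  ext w j
  simp only [mul_apply_eq_comp, tensorOp_apply, map_sum, map_smul,
    Matrix.mul_apply, Finset.smul_sum, Finset.sum_smul, smul_smul]
  exact Finset.sum_comm

theorem tensorOp_one : tensorOp (1 : TwoModeOp) (1 : K →L[ℂ] K) = 1 := by
  ext w j
  simp [tensorOp_apply, Matrix.one_apply]

theorem star_tensorOp (A : TwoModeOp) (T : K →L[ℂ] K) :
    star (tensorOp A T) = tensorOp (star A) (star T) := by
  symm
  rw [ContinuousLinearMap.star_eq_adjoint (tensorOp A T), ContinuousLinearMap.eq_adjoint_iff]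
  intro v w
  rw [inner_tensorOp]
  simp only [PiLp.inner_apply, tensorOp_apply, sum_inner, inner_smul_left]
  rw [Finset.sum_comm]
  refine Finset.sum_congr rfl fun j _ => Finset.sum_congr rfl fun k _ => ?_
  rw [ContinuousLinearMap.star_eq_adjoint, ContinuousLinearMap.adjoint_inner_left,
    Matrix.star_apply]
  simp

theorem tensorOp_mem_unitary {V : TwoModeOp} {T : K →L[ℂ] K} (hV : V ∈ unitary TwoModeOp)
    (hT : T ∈ unitary (K →L[ℂ] K)) : tensorOp V T ∈ unitary (Global K →L[ℂ] Global K) := by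
  rw [Unitary.mem_iff, star_tensorOp, tensorOp_mul, tensorOp_mul,
    Unitary.star_mul_self_of_mem hV, Unitary.mul_star_self_of_mem hV,
    Unitary.star_mul_self_of_mem hT, Unitary.mul_star_self_of_mem hT]
  exact ⟨tensorOp_one, tensorOp_one⟩

theorem block_tensorOp (A : TwoModeOp) (T : K →L[ℂ] K) (j k : Occ × Occ) :
    block (tensorOp A T) j k = A j k • T := by
  ext x
  simp only [block, ContinuousLinearMap.comp_apply, component_apply, tensorOp_apply,
    component_adjoint_apply]
  rw [Finset.sum_eq_single k]
  · simp
  · intro l _ hl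
    simp [hl]
  · simp

theorem reducedR_tensorOp (A : TwoModeOp) (T : K →L[ℂ] K) :
    reducedR (tensorOp A T) = A.trace • T := by
  simp only [reducedR, block_tensorOp, Matrix.trace, Matrix.diag, Finset.sum_smul]

namespace Reservoir

variable {R : Reservoir ι K} {β : ℝ}

theorem reducedMS_tensorOp_gibbs [Nontrivial K] (hZ : R.HasPartitionFunction β) (A : TwoModeOp) :
    reducedMS R.basis (tensorOp A (R.gibbs β)) = A := by
  ext j k
  have h := ((Complex.hasSum_ofReal.2 (hasSum_gibbsWeight hZ)).mul_left (A j k)).tsum_eq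
  simpa [reducedMS, block_tensorOp, inner_smul_right, inner_gibbs_basis hZ] using h

theorem evolution_mem_unitary (R : Reservoir ι K) (τ : ℝ) :
    R.evolution τ ∈ unitary (K →L[ℂ] K) := by
  set e := R.basis.repr.trans (R.phaseBasis τ).repr.symm
  have h : star (R.evolution τ) = (e.symm.toContinuousLinearEquiv : K →L[ℂ] K) :=
    e.adjoint_eq_symm
  rw [Unitary.mem_iff, h]
  constructor <;> ext x
  · exact e.symm_apply_apply x
  · exact e.apply_symm_apply x

theorem evolution_mul_gibbs [Nontrivial K] (hZ : R.HasPartitionFunction β) (τ : ℝ) :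
    R.evolution τ * R.gibbs β = R.gibbs β * R.evolution τ := by
  refine ContinuousLinearMap.ext_on
    (Submodule.dense_iff_topologicalClosure_eq_top.2 R.basis.dense_span) ?_
  rintro _ ⟨i, rfl⟩
  simp only [mul_apply_eq_comp, gibbs_basis hZ, evolution_basis, map_smul]
  exact smul_comm _ _ _

theorem finalState_isolated [Nontrivial K] (hZ : R.HasPartitionFunction β) (ρ V : TwoModeOp)
    (τ : ℝ) : R.finalState β ρ (tensorOp V (R.evolution τ))
      = tensorOp (V * ρ * star V) (R.gibbs β) := by
  rw [finalState, star_tensorOp, tensorOp_mul, tensorOp_mul, evolution_mul_gibbs hZ,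
    mul_assoc (R.gibbs β), Unitary.mul_star_self_of_mem (evolution_mem_unitary R τ), mul_one]

end Reservoir

end Isolated

/-! ### The one-body state and the tunnel coupling -/

theorem oneBody_apply (j : Occ × Occ) :
    oneBody j = ((Real.sqrt 2)⁻¹ : ℂ) *
      (if j = (1, 0) then 1 else if j = (0, 1) then Complex.I else 0) := by
  obtain ⟨m, s⟩ := j
  fin_cases m <;> fin_cases s <;> simp [oneBody]

theorem inv_sqrt_two_mul_self : ((Real.sqrt 2)⁻¹ : ℂ) * ((Real.sqrt 2)⁻¹ : ℂ) = 2⁻¹ := by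
  rw [← mul_inv, ← Complex.ofReal_mul, Real.mul_self_sqrt (by norm_num)]
  norm_num

theorem pureState_oneBody_apply (j k : Occ × Occ) :
    pureState oneBody j k = 2⁻¹ * ((if j = (1, 0) then 1 else if j = (0, 1) then Complex.I else 0)
      * (if k = (1, 0) then 1 else if k = (0, 1) then -Complex.I else 0)) := by
  have h : star (oneBody k) = ((Real.sqrt 2)⁻¹ : ℂ) *
      (if k = (1, 0) then 1 else if k = (0, 1) then -Complex.I else 0) := by
    rw [oneBody_apply]
    split_ifs <;> simp
  rw [pureState, Matrix.vecMulVec_apply, Pi.star_apply, h, oneBody_apply, ← inv_sqrt_two_mul_self]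
  ring

theorem isFermionicState_pureState_oneBody : IsFermionicState (pureState oneBody) where
  posSemidef := Matrix.posSemidef_vecMulVec_self_star _
  trace_eq_one := by
    simp [Matrix.trace, Fintype.sum_prod_type, pureState_oneBody_apply]
    norm_num
  superselection := by
    rw [commute_parity_iff]
    rintro ⟨m, s⟩ ⟨m', s'⟩ h
    rw [pureState_oneBody_apply]
    fin_cases m <;> fin_cases s <;> fin_cases m' <;> fin_cases s' <;> simp_all

theorem pureState_zeroOne_apply (j k : Occ × Occ) :
    pureState zeroOne j k = if j = (0, 1) ∧ k = (0, 1) then 1 else 0 := by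
  rw [pureState, Matrix.vecMulVec_apply, Pi.star_apply, zeroOne, Pi.single_apply, Pi.single_apply]
  split_ifs <;> simp_all

theorem propagator_mem_unitary {H : TwoModeOp} (hH : star H = H) (hbar t : ℝ) :
    propagator hbar H t ∈ unitary TwoModeOp := by
  have h : star (propagator hbar H t)
      = NormedSpace.exp (-((-Complex.I * ((t / hbar : ℝ) : ℂ)) • H)) := by
    rw [propagator, Matrix.star_eq_conjTranspose, ← Matrix.exp_conjTranspose,
      ← Matrix.star_eq_conjTranspose, star_smul, hH]
    congr 1
    simp
  rw [Unitary.mem_iff, h, propagator]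
  have hc := Commute.refl ((-Complex.I * ((t / hbar : ℝ) : ℂ)) • H)
  rw [← Matrix.exp_add_of_commute _ _ hc.neg_left, ← Matrix.exp_add_of_commute _ _ hc.neg_right]
  simp

/-- The hopping operator `c_M† c_S + c_S† c_M` exchanges `|1_M⟩|0_S⟩` and `|0_M⟩|1_S⟩`. -/
theorem hopping_eq : annM.conjTranspose * annS + annS.conjTranspose * annM
    = fun j k => if (j = (1, 0) ∧ k = (0, 1)) ∨ (j = (0, 1) ∧ k = (1, 0)) then (1 : ℂ) else 0 := by
  ext ⟨a, b⟩ ⟨c, d⟩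
  fin_cases a <;> fin_cases b <;> fin_cases c <;> fin_cases d <;>
    simp [annM, annS, Matrix.mul_apply]

/-- The unnormalized eigenvectors of the hopping operator: the columns `(0, 1)` and `(1, 0)` are
the sum and the difference of `|0_M⟩|1_S⟩` and `|1_M⟩|0_S⟩`, with eigenvalues `1` and `-1`. -/
def hoppingEigenvectors : TwoModeOp := fun j k =>
  if k.1 = k.2 then (if j = k then 1 else 0)
  else if j.1 = j.2 then 0 else if j = (1, 0) ∧ k = (1, 0) then -1 else 1

/-- The inverse of `hoppingEigenvectors`. -/
def hoppingEigenvectorsInv : TwoModeOp := fun j k =>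
  (if k.1 = k.2 then 1 else 2⁻¹) * hoppingEigenvectors j k

/-- `hoppingEigenvectors` as an invertible matrix. -/
def hoppingEigenvectorsUnit : TwoModeOpˣ where
  val := hoppingEigenvectors
  inv := hoppingEigenvectorsInv
  val_inv := by
    ext ⟨a, b⟩ ⟨c, d⟩
    fin_cases a <;> fin_cases b <;> fin_cases c <;> fin_cases d <;>
      simp [hoppingEigenvectors, hoppingEigenvectorsInv, Matrix.mul_apply,
        Fintype.sum_prod_type] <;> norm_num
  inv_val := by
    ext ⟨a, b⟩ ⟨c, d⟩
    fin_cases a <;> fin_cases b <;> fin_cases c <;> fin_cases d <;>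
      simp [hoppingEigenvectors, hoppingEigenvectorsInv, Matrix.mul_apply,
        Fintype.sum_prod_type] <;> norm_num

/-- The eigenvalues of the hopping operator. -/
def hoppingEigenvalue (j : Occ × Occ) : ℂ := if j.1 = j.2 then 0 else if j = (0, 1) then 1 else -1

theorem hopping_diagonalization :
    annM.conjTranspose * annS + annS.conjTranspose * annM
      = hoppingEigenvectors * Matrix.diagonal hoppingEigenvalue * hoppingEigenvectorsInv := by
  rw [hopping_eq]
  ext ⟨a, b⟩ ⟨c, d⟩
  fin_cases a <;> fin_cases b <;> fin_cases c <;> fin_cases d <;>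
    simp [hoppingEigenvectors, hoppingEigenvectorsInv, hoppingEigenvalue, Matrix.mul_apply,
      Matrix.diagonal_apply, Fintype.sum_prod_type] <;> norm_num

theorem exp_smul_hopping (z : ℂ) :
    NormedSpace.exp (z • (annM.conjTranspose * annS + annS.conjTranspose * annM))
      = hoppingEigenvectors * Matrix.diagonal (fun j => Complex.exp (z * hoppingEigenvalue j))
          * hoppingEigenvectorsInv := by
  have h := Matrix.exp_units_conj hoppingEigenvectorsUnit
    (Matrix.diagonal (fun j => z * hoppingEigenvalue j))
  rw [Matrix.exp_diagonal] at h
  have e : z • (annM.conjTranspose * annS + annS.conjTranspose * annM)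
      = (hoppingEigenvectorsUnit : TwoModeOp) * Matrix.diagonal (fun j => z * hoppingEigenvalue j)
        * ((hoppingEigenvectorsUnit⁻¹ : TwoModeOpˣ) : TwoModeOp) := by
    rw [hopping_diagonalization]
    change _ = hoppingEigenvectors * _ * hoppingEigenvectorsInv
    rw [← Matrix.smul_mul, ← Matrix.mul_smul, ← Matrix.diagonal_smul]
    rfl
  rw [e, h]
  change hoppingEigenvectors * _ * hoppingEigenvectorsInv = _
  congr 3
  ext j
  rw [Pi.coe_exp, Complex.exp_eq_exp_ℂ]

/-- A hopping evolution with `exp (2 z) = i` rotates the one-body state into `|0_M⟩|1_S⟩`, up to a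
phase. -/
theorem exp_smul_hopping_mulVec_oneBody {z : ℂ} (hz : Complex.exp z * Complex.exp z = Complex.I) :
    Matrix.mulVec
      (NormedSpace.exp (z • (annM.conjTranspose * annS + annS.conjTranspose * annM))) oneBody
      = ((Real.sqrt 2 : ℂ)⁻¹ * (Complex.exp (-z) * (Complex.I - 1)) : ℂ) • zeroOne := by
  have h0 : Complex.exp z = Complex.exp (-z) * Complex.I := by
    rw [← hz, ← mul_assoc, ← Complex.exp_add, neg_add_cancel, Complex.exp_zero, one_mul]
  rw [exp_smul_hopping]
  ext ⟨a, b⟩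
  have hI := Complex.I_mul_I
  fin_cases a <;> fin_cases b <;>
    simp [Matrix.mulVec, dotProduct, hoppingEigenvectors, hoppingEigenvectorsInv,
      hoppingEigenvalue, Matrix.mul_apply, Matrix.diagonal_apply, Fintype.sum_prod_type,
      oneBody_apply, zeroOne, h0]
  · linear_combination ((Real.sqrt 2 : ℂ)⁻¹ * Complex.exp (-z) * 2⁻¹ : ℂ) * hI
  · linear_combination ((Real.sqrt 2 : ℂ)⁻¹ * Complex.exp (-z) * 2⁻¹ : ℂ) * hI

theorem mul_pureState_mul_star (V : TwoModeOp) (ψ : Occ × Occ → ℂ) :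
    V * pureState ψ * star V = pureState (Matrix.mulVec V ψ) := by
  rw [pureState, pureState, Matrix.mul_vecMulVec, Matrix.vecMulVec_mul, Matrix.star_mulVec,
    Matrix.star_eq_conjTranspose]

theorem pureState_smul_zeroOne {c : ℂ} (hc : c * star c = 1) :
    pureState (c • zeroOne) = pureState zeroOne := by
  rw [pureState, pureState, star_smul, Matrix.smul_vecMulVec, Matrix.vecMulVec_smul, smul_smul, hc,
    one_smul]

/-- The tunnel coupling at the stated times realizes the step to `|0_M⟩|1_S⟩`. -/
theorem propagator_tunnel {hbar Ω t : ℝ} (hb : 0 < hbar)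
    (h : (Ω < 0 ∧ t = Real.pi / (4 * |Ω|)) ∨ (0 < Ω ∧ t = 3 * Real.pi / (4 * Ω))) :
    propagator hbar (hamMS hbar 0 0 Ω) t ∈ unitary TwoModeOp ∧
    propagator hbar (hamMS hbar 0 0 Ω) t * pureState oneBody *
      star (propagator hbar (hamMS hbar 0 0 Ω) t) = pureState zeroOne := by
  have hH : hamMS hbar 0 0 Ω = ((hbar * Ω : ℝ) : ℂ) •
      (annM.conjTranspose * annS + annS.conjTranspose * annM) := by
    simp [hamMS]
  refine ⟨propagator_mem_unitary ?_ hbar t, ?_⟩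
  · rw [hH, star_smul, star_add, Matrix.star_eq_conjTranspose, Matrix.star_eq_conjTranspose,
      Matrix.conjTranspose_mul, Matrix.conjTranspose_mul, Matrix.conjTranspose_conjTranspose,
      Matrix.conjTranspose_conjTranspose, add_comm]
    simp
  have hV : propagator hbar (hamMS hbar 0 0 Ω) t
      = NormedSpace.exp ((((-(Ω * t) : ℝ) : ℂ) * Complex.I) •
        (annM.conjTranspose * annS + annS.conjTranspose * annM)) := by
    rw [propagator, hH, smul_smul]
    congr 2
    have : (hbar : ℂ) ≠ 0 := by exact_mod_cast hb.ne'
    push_cast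
    field_simp
  set θ : ℝ := -(Ω * t)
  have hz : Complex.exp ((θ : ℂ) * Complex.I) * Complex.exp ((θ : ℂ) * Complex.I) = Complex.I := by
    rw [← Complex.exp_add]
    rcases h with ⟨hΩ, ht⟩ | ⟨hΩ, ht⟩
    · have hθ : θ = Real.pi / 4 := by
        have := hΩ.ne
        simp only [θ, ht, abs_of_neg hΩ]
        field_simp
      rw [hθ, show ((Real.pi / 4 : ℝ) : ℂ) * Complex.I + ((Real.pi / 4 : ℝ) : ℂ) * Complex.I
        = Real.pi / 2 * Complex.I by push_cast; ring, Complex.exp_pi_div_two_mul_I]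
    · have hθ : θ = Real.pi / 4 - Real.pi := by
        simp only [θ, ht]
        field_simp
        ring
      rw [hθ, show ((Real.pi / 4 - Real.pi : ℝ) : ℂ) * Complex.I
        + ((Real.pi / 4 - Real.pi : ℝ) : ℂ) * Complex.I
        = Real.pi / 2 * Complex.I - 2 * Real.pi * Complex.I by push_cast; ring,
        Complex.exp_periodic.sub_eq, Complex.exp_pi_div_two_mul_I]
  rw [mul_pureState_mul_star, hV, exp_smul_hopping_mulVec_oneBody hz]
  refine pureState_smul_zeroOne ?_
  rw [mul_star_self_eq_norm_sq, ← neg_mul, ← Complex.ofReal_neg, norm_mul, norm_mul,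
    Complex.norm_exp_ofReal_mul_I]
  have h2 : ‖Complex.I - 1‖ ^ 2 = 2 := by
    rw [← Complex.normSq_eq_norm_sq, Complex.normSq_apply]
    norm_num
  have h3 : ‖((Real.sqrt 2)⁻¹ : ℂ)‖ ^ 2 = 2⁻¹ := by
    rw [norm_inv, Complex.norm_real, inv_pow, Real.norm_eq_abs, sq_abs, Real.sq_sqrt (by norm_num)]
  rw [one_mul, mul_pow, h2, h3]
  norm_num

section Violation

variable {ι K : Type*} [NormedAddCommGroup K] [InnerProductSpace ℂ K] [CompleteSpace K]
  [Nontrivial K] {R : Reservoir ι K} {β : ℝ}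

/-- The values attained when an isolated reservoir accompanies a step from the one-body state to
`|0_M⟩|1_S⟩`: the initial mode entropies are `log 2`, all other terms vanish. -/
theorem Reservoir.violation (hZ : R.HasPartitionFunction β) (hE : R.HasFiniteEnergy (R.gibbs β))
    {V : TwoModeOp} (hV : V * pureState oneBody * star V = pureState zeroOne) (τ : ℝ) :
    reducedMS R.basis (R.finalState β (pureState oneBody) (tensorOp V (R.evolution τ)))
      = pureState zeroOne ∧
    R.HasFiniteEnergy
      (reducedR (R.finalState β (pureState oneBody) (tensorOp V (R.evolution τ)))) ∧
    R.heat β (pureState oneBody) (tensorOp V (R.evolution τ)) = 0 ∧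
    R.witness β (pureState oneBody) (tensorOp V (R.evolution τ)) = -Real.log 2 := by
  have hfin := finalState_isolated hZ (pureState oneBody) V τ
  rw [hV] at hfin
  have hMS := reducedMS_tensorOp_gibbs hZ (pureState zeroOne)
  have hR : reducedR (tensorOp (pureState zeroOne) (R.gibbs β)) = R.gibbs β := by
    have : (pureState zeroOne).trace = 1 := by
      simp [Matrix.trace, pureState_zeroOne_apply]
    rw [reducedR_tensorOp, this, one_smul]
  have hheat : R.heat β (pureState oneBody) (tensorOp V (R.evolution τ)) = 0 := by
    rw [heat, hfin, hR, sub_self, neg_zero]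
  refine ⟨by rw [hfin, hMS], by rwa [hfin, hR], hheat, ?_⟩
  rw [witness, hheat, hfin, hMS]
  simp only [occupancy_annM, occupancy_annS, pureState_zeroOne_apply, pureState_oneBody_apply]
  simp

end Violation

end FermionThermo

end

open FermionThermo in
theorem mainTheorem2 {ι K : Type*} [NormedAddCommGroup K] [InnerProductSpace ℂ K]
    [CompleteSpace K] [Nontrivial K] (R : Reservoir ι K) (β : ℝ) (hβ : 0 < β)
    (hZ : R.HasPartitionFunction β) (hE : R.HasFiniteEnergy (R.gibbs β)) :
    -- the inequality holds for separable initial states under every process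
    (∀ ρ : TwoModeOp, IsFermionicState ρ → IsSeparable ρ →
      ∀ U ∈ unitary (Global K →L[ℂ] Global K),
        R.HasFiniteEnergy (reducedR (R.finalState β ρ U)) → 0 ≤ R.witness β ρ U) ∧
    -- its violation certifies initial entanglement
    (∀ ρ : TwoModeOp, IsFermionicState ρ →
      ∀ U ∈ unitary (Global K →L[ℂ] Global K),
        R.HasFiniteEnergy (reducedR (R.finalState β ρ U)) → R.witness β ρ U < 0 →
          ¬ IsSeparable ρ) ∧
    -- every unitary step from the one-body state to `|0_M⟩|1_S⟩`, with the reservoir isolated,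
    -- has zero heat and violates the inequality
    IsFermionicState (pureState oneBody) ∧
    (∀ V ∈ unitary TwoModeOp,
      V * pureState oneBody * star V = pureState zeroOne → ∀ τ : ℝ,
        tensorOp V (R.evolution τ) ∈ unitary (Global K →L[ℂ] Global K) ∧
        reducedMS R.basis (R.finalState β (pureState oneBody) (tensorOp V (R.evolution τ)))
          = pureState zeroOne ∧
        R.HasFiniteEnergy
          (reducedR (R.finalState β (pureState oneBody) (tensorOp V (R.evolution τ)))) ∧
        R.heat β (pureState oneBody) (tensorOp V (R.evolution τ)) = 0 ∧
        R.witness β (pureState oneBody) (tensorOp V (R.evolution τ)) = -Real.log 2 ∧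
        R.witness β (pureState oneBody) (tensorOp V (R.evolution τ)) < 0) ∧
    -- such a step is realized by the tunnel coupling at zero mode energies
    (∀ hbar Ω t : ℝ, 0 < hbar →
      (Ω < 0 ∧ t = Real.pi / (4 * |Ω|)) ∨ (0 < Ω ∧ t = 3 * Real.pi / (4 * Ω)) →
        propagator hbar (hamMS hbar 0 0 Ω) t ∈ unitary TwoModeOp ∧
        propagator hbar (hamMS hbar 0 0 Ω) t * pureState oneBody *
          star (propagator hbar (hamMS hbar 0 0 Ω) t) = pureState zeroOne) := by
  have h1 : ∀ ρ : TwoModeOp, IsFermionicState ρ → IsSeparable ρ →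
      ∀ U ∈ unitary (Global K →L[ℂ] Global K),
        R.HasFiniteEnergy (reducedR (R.finalState β ρ U)) → 0 ≤ R.witness β ρ U :=
    fun _ hF hS _ hU hE1 => Reservoir.witness_nonneg hZ hE hF hS hU hE1
  refine ⟨h1, fun ρ hF U hU hE1 hneg hS => (h1 ρ hF hS U hU hE1).not_gt hneg,
    isFermionicState_pureState_oneBody, fun V hV hVΨ τ => ?_,
    fun _ _ _ hb h => propagator_tunnel hb h⟩
  obtain ⟨hMS, hfin, hheat, hw⟩ := Reservoir.violation hZ hE hVΨ τ
  refine ⟨tensorOp_mem_unitary hV (R.evolution_mem_unitary τ), hMS, hfin, hheat, hw, ?_⟩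
  rw [hw, neg_lt_zero]
  exact Real.log_pos one_lt_two
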